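/- For a probability distribution $f$ on $\mathbb R$ and $r>0$, let $f_r$ be the density of $Y+Z$ with $Y\sim f$, $Z\sim\mathcal N(0,r^2)$ independent, let $s_r=f_r'/f_r$ be its score and $\mathcal I_r=\mathbb E_{x\sim f_r}[s_r(x)^2]$ its Fisher information. A $p$-quantile of $f$ is any $z$ with $f((-\infty,z))\le p\le f((-\infty,z])$; a sample $p$-quantile is a $p$-quantile of the empirical distribution; $\mathrm{IQR}=q_3-q_1$ for a $\tfrac14$-quantile $q_1$ and a $\tfrac34$-quantile $q_3$ of $f$. Logarithms are natural. Global two-stage MLE. Input: $f$, $\delta\in(0,1)$, a smoothing radius $r^*>0$, and i.i.d. samples $x_1,\dots,x_n$ of $\lambda+\eta$, $\eta\sim f$, with $\lambda\in\mathbb R$ unknown. (1) With $t=\sqrt{2\log(4/\delta)/n}$, compute $\alpha\in[t,1-t]$, an $(\alpha-t)$-quantile $a$ and an $(\alpha+t)$-quantile $b$ of $f$ such that $b-a$ is the smallest possible. (2) Take a sample $\alpha$-quantile $x_\alpha$ and let $[\ell,u]=[x_\alpha-b,\;x_\alpha-a]$. (3) Put $x_i'=x_i+z_i$ with $z_1,\dots,z_n\sim\mathcal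 N(0,(r^*)^2)$ independent of each other and of the samples, and $\hat s(\theta)=\sum_{i=1}^n s_{r^*}(x_i'-\theta)$. Return any root $\hat\lambda\in[\ell,u]$ of $\hat s$; if there is none, return $u$ if $\hat s<0$ on $[\ell,u]$ and $\ell$ if $\hat s>0$ on $[\ell,u]$. Theorem (Global MLE). For all constants $c_1,c_2>0$ there are constants $C,C_0>0$, depending only on $c_1,c_2$, such that the following holds for every probability distribution $f$ on $\mathbb R$, every $\delta\in(0,1)$, every $n\ge C_0\log\frac4\delta$, and every $r^*>0$ with $$r^*\;\ge\; c_1\max\Bigl(\bigl(\tfrac{\log(1/\delta)}{n}\bigr)^{1/8},\,2^{-c_2\sqrt{\log(1/\delta)}}\Bigr)\cdot\mathrm{IQR}.$$ A minimizing $(\alpha,a,b)$ as in step (1) exists, and for every such choice and every $\lambda\in\mathbb R$, with probability at least $1-\delta$ over the samples and the perturbations, the algorithm has an output and every possible output $\hat\lambda$ satisfies $$|\hat\lambda-\lambda|\;\le\;\Bigl(1+C\bigl(\tfrac{\log(1/\delta)}{n}\bigr)^{1/4}+\tfrac{C}{\sqrt{\log(1/\delta)}}\Bigr)\sqrt{\frac{2\log(1/\delta)}{n\,\mathcal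 I_{r^*}}}.$$ -/

import Mathlib

open MeasureTheory ProbabilityTheory

namespace LocationMLE

noncomputable section

/-- Density of the `r`-smoothed version of `f`, i.e. of `Y + Z` with `Y ∼ f` and
`Z ∼ N(0, r²)` independent. -/
def smoothedDensity (f : Measure ℝ) (r : ℝ) (x : ℝ) : ℝ :=
  ∫ y, gaussianPDFReal 0 (r ^ 2).toNNReal (x - y) ∂f

/-- Score function `s_r = (log f_r)' = f_r' / f_r` of the `r`-smoothed distribution. -/
def score (f : Measure ℝ) (r : ℝ) : ℝ → ℝ :=
  logDeriv (smoothedDensity f r)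

/-- Fisher information `I_r = E_{x ∼ f_r} [s_r(x)²]` of the `r`-smoothed distribution. -/
def fisherInfo (f : Measure ℝ) (r : ℝ) : ℝ :=
  ∫ x, score f r x ^ 2 * smoothedDensity f r x

/-- `z` is a `p`-quantile of `f`: `f((-∞, z)) ≤ p ≤ f((-∞, z])`. -/
def IsQuantile (f : Measure ℝ) (p z : ℝ) : Prop :=
  f.real (Set.Iio z) ≤ p ∧ p ≤ f.real (Set.Iic z)

/-- `z` is a sample `p`-quantile of `x₁, …, xₙ`, i.e. a `p`-quantile of the empirical measure. -/
def IsSampleQuantile {n : ℕ} (x : Fin n → ℝ) (p z : ℝ) : Prop :=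
  ((Finset.univ.filter fun i => x i < z).card : ℝ) ≤ p * n ∧
    p * n ≤ ((Finset.univ.filter fun i => x i ≤ z).card : ℝ)

/-- Half-width (in quantile level) `√(2 log(4/δ) / n)` of the initial quantile window. -/
def quantileRadius (δ : ℝ) (n : ℕ) : ℝ :=
  √(2 * Real.log (4 / δ) / n)

/-- `α ∈ [t, 1 - t]`, and `[a, b]` is the interval between an `(α - t)`-quantile and an
`(α + t)`-quantile of `f`, of the smallest length possible over all such `α`. -/
structure IsShortestWindow (f : Measure ℝ) (t α a b : ℝ) : Prop where
  mem : α ∈ Set.Icc t (1 - t)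
  left : IsQuantile f (α - t) a
  right : IsQuantile f (α + t) b
  shortest : ∀ α' a' b' : ℝ, α' ∈ Set.Icc t (1 - t) →
    IsQuantile f (α' - t) a' → IsQuantile f (α' + t) b' → b - a ≤ b' - a'

/-- Empirical score `ŝ(θ) = ∑ᵢ s_r(x'ᵢ - θ)`. -/
def empiricalScore (f : Measure ℝ) (r : ℝ) {n : ℕ} (x' : Fin n → ℝ) (θ : ℝ) : ℝ :=
  ∑ i, score f r (x' i - θ)

/-- `θ` is a possible output of the local smoothed MLE on `[l, u]`, run on the perturbed samples
`x'`: any root of the empirical score in `[l, u]`. If there is no root, the empirical score has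
constant sign on `[l, u]` and the output is the endpoint maximizing the likelihood on `[l, u]`
(the derivative of the log-likelihood at `θ` is `-ŝ(θ)`). -/
def IsLocalMLEOutput (f : Measure ℝ) (r : ℝ) {n : ℕ} (x' : Fin n → ℝ) (l u θ : ℝ) : Prop :=
  θ ∈ Set.Icc l u ∧
    (empiricalScore f r x' θ = 0 ∨
      ((∀ τ ∈ Set.Icc l u, empiricalScore f r x' τ < 0) ∧ θ = u) ∨
      ((∀ τ ∈ Set.Icc l u, 0 < empiricalScore f r x' τ) ∧ θ = l))

/-- `θ` is a possible output of the global two-stage MLE with quantile window `(α, a, b)` and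
smoothing radius `r`, on the samples `x` and the Gaussian perturbations `z`: a sample `α`-quantile
`q` of `x` gives the initial interval `[q - b, q - a]`, on which the local smoothed MLE is run. -/
def IsGlobalMLEOutput (f : Measure ℝ) (r α a b : ℝ) {n : ℕ} (x z : Fin n → ℝ) (θ : ℝ) : Prop :=
  ∃ q : ℝ, IsSampleQuantile x α q ∧
    IsLocalMLEOutput f r (fun i => x i + z i) (q - b) (q - a) θ

end

end LocationMLE

open LocationMLE

/-! Write `L = log (1/δ)`, `γ = L / n`, `I` for the Fisher information at radius `r` and `w = IQR /
r`. Two events suffice. The first is that the initial interval contains `lam`: this is Hoeffding's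
inequality for the counts of samples below `lam + a` and above `lam + b`
(`measureReal_window_miss_le`). The second is that the empirical score at `lam ± ε` has the sign of
`±ε` for all `ε` between the target accuracy `ε₀` and the interval length `b - a`; every output then
lies within `ε₀` of `lam`.

For one shift `ε`, Chernoff's bound is used with exponent `-ε`. Shifting the Gaussian noise tilts
its law by `exp (e u - e² / 2)`, where `e = ε / r` and `u = -Z / r`. Since the score is the
conditional mean of `-Z / r²` given `Y + Z`, it is centred, sub-Gaussian at scale `1 / r`, and has
covariance `I` with `-Z / r²`. Expanding to second order gives `E exp (-ε s(x - ε)) ≤ 1 - ε² I / 2 +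
O(|ε|³ √I / r²)` (`integral_exp_shifted_score_le`). The leading term produces the sharp constant in
`√(2 L / (n I))`.

Uniformity in `ε` comes from convexity of a cumulant generating function: the score plus `x / r²` is
nondecreasing, so the empirical score has a one-sided Lipschitz constant `n / r²` and a net of `N`
shifts is enough (`measureReal_wrong_sign_le`).

The errors are then compared with `ε² I / 2`. The shortest window has length at most `8 t IQR` with
`t` of order `√γ` when `L ≥ 1` (`IsShortestWindow.length_le`), and `√I ≥ 1 / (4 (IQR + 14 r))`
(`one_le_sqrt_fisherInfo`), so the relative cubic error is of order `t w (w + 14)`. The hypothesis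
`w ≲ γ^(-1/8)` makes this `O(γ^(1/4))`. The hypothesis `w ≤ 2^(c₂ √L) / c₁` makes `log N = O(1 +
√L)`, which the term `C / √L` in the accuracy absorbs. -/

namespace LocationMLE

noncomputable section

/-! ### The smoothed density as a moment generating function; structure of the score -/

/-- The density of `N(0, r²)`. -/
def kern (r x : ℝ) : ℝ := gaussianPDFReal 0 (r ^ 2).toNNReal x

lemma toNNReal_sq_ne_zero {r : ℝ} (hr : 0 < r) : (r ^ 2).toNNReal ≠ 0 := by
  simpa using hr.ne'

lemma coe_toNNReal_sq (r : ℝ) : (((r ^ 2).toNNReal : NNReal) : ℝ) = r ^ 2 :=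
  Real.coe_toNNReal _ (sq_nonneg r)

lemma kern_eq (r x : ℝ) :
    kern r x = (√(2 * Real.pi * r ^ 2))⁻¹ * Real.exp (-x ^ 2 / (2 * r ^ 2)) := by
  rw [kern, gaussianPDFReal, coe_toNNReal_sq, sub_zero]

lemma kern_pos {r : ℝ} (hr : 0 < r) (x : ℝ) : 0 < kern r x :=
  gaussianPDFReal_pos _ _ _ (toNNReal_sq_ne_zero hr)

lemma kern_nonneg (r x : ℝ) : 0 ≤ kern r x := gaussianPDFReal_nonneg _ _ _

lemma measurable_kern (r : ℝ) : Measurable (kern r) := measurable_gaussianPDFReal _ _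

lemma kern_add {r : ℝ} (x h : ℝ) :
    kern r (x + h) = kern r x * Real.exp (-(h * x) / r ^ 2 - h ^ 2 / (2 * r ^ 2)) := by
  rw [kern_eq, kern_eq, mul_assoc (√(2 * Real.pi * r ^ 2))⁻¹, ← Real.exp_add]
  congr 2
  ring

lemma smoothedDensity_eq (f : Measure ℝ) (r x : ℝ) :
    smoothedDensity f r x = ∫ y, kern r (x - y) ∂f := rfl

/-- The measure `f` weighted by `y ↦ exp (-y² / (2 r²))`: its moment generating function is, up to
an explicit factor, the smoothed density of `f`. -/
def gaussWeighted (f : Measure ℝ) (r : ℝ) : Measure ℝ :=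
  f.withDensity fun y => ENNReal.ofReal (Real.exp (-y ^ 2 / (2 * r ^ 2)))

lemma measurable_gaussWeight (r : ℝ) :
    Measurable fun y : ℝ => ENNReal.ofReal (Real.exp (-y ^ 2 / (2 * r ^ 2))) := by fun_prop

lemma integral_gaussWeighted (f : Measure ℝ) (r : ℝ) (g : ℝ → ℝ) :
    ∫ y, g y ∂(gaussWeighted f r) = ∫ y, Real.exp (-y ^ 2 / (2 * r ^ 2)) * g y ∂f := by
  rw [gaussWeighted, integral_withDensity_eq_integral_toReal_smul (measurable_gaussWeight r)
    (by simp)]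
  simp [ENNReal.toReal_ofReal, Real.exp_nonneg]

lemma integrable_gaussWeighted_iff (f : Measure ℝ) (r : ℝ) (g : ℝ → ℝ) :
    Integrable g (gaussWeighted f r) ↔
      Integrable (fun y => Real.exp (-y ^ 2 / (2 * r ^ 2)) * g y) f := by
  rw [gaussWeighted, integrable_withDensity_iff_integrable_smul' (measurable_gaussWeight r)
    (by simp)]
  simp [ENNReal.toReal_ofReal, Real.exp_nonneg]

variable {f : Measure ℝ} {r : ℝ}

/-- Expanding `(x - y)²` leaves only the cross term `x y / r²` coupling `x` and `y`. Gaussian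
convolution thus becomes an exponential tilt, and the calculus of `mgf` and `cgf` applies. -/
lemma kern_sub_eq (hr : 0 < r) (x y : ℝ) :
    kern r (x - y) = kern r x *
      (Real.exp (-y ^ 2 / (2 * r ^ 2)) * Real.exp (x / r ^ 2 * y)) := by
  rw [kern_eq, kern_eq, mul_assoc (√(2 * Real.pi * r ^ 2))⁻¹, ← Real.exp_add, ← Real.exp_add]
  congr 2
  field_simp
  ring

lemma integral_mul_kern (hr : 0 < r) (x : ℝ) (g : ℝ → ℝ) :
    ∫ y, g y * kern r (x - y) ∂f =
      kern r x * ∫ y, g y * Real.exp (x / r ^ 2 * y) ∂(gaussWeighted f r) := by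
  rw [integral_gaussWeighted, ← integral_const_mul]
  refine integral_congr_ae (ae_of_all _ fun y => ?_)
  simp only [kern_sub_eq hr x y]
  ring

lemma integrable_mul_kern_iff (hr : 0 < r) (x : ℝ) (g : ℝ → ℝ) :
    Integrable (fun y => g y * kern r (x - y)) f ↔
      Integrable (fun y => g y * Real.exp (x / r ^ 2 * y)) (gaussWeighted f r) := by
  rw [integrable_gaussWeighted_iff, ← integrable_const_mul_iff (kern_pos hr x).ne'.isUnit
    (fun y => Real.exp (-y ^ 2 / (2 * r ^ 2)) * (g y * Real.exp (x / r ^ 2 * y)))]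
  refine integrable_congr (ae_of_all _ fun y => ?_)
  simp only [kern_sub_eq hr x y]
  ring

lemma smoothedDensity_eq_mgf (hr : 0 < r) (x : ℝ) :
    smoothedDensity f r x = kern r x * mgf id (gaussWeighted f r) (x / r ^ 2) := by
  have := integral_mul_kern (f := f) hr x 1
  simpa [mgf, smoothedDensity_eq] using this

variable [IsProbabilityMeasure f]

/-- Completing the square bounds the integrand by a constant, so `f` needs no moments. -/
lemma integrable_exp_gaussWeighted (hr : 0 < r) (t : ℝ) :
    Integrable (fun y => Real.exp (t * id y)) (gaussWeighted f r) := by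
  rw [integrable_gaussWeighted_iff]
  refine Integrable.of_bound (C := Real.exp (t ^ 2 * r ^ 2 / 2)) (by fun_prop) ?_
  filter_upwards with y
  rw [← Real.exp_add, Real.norm_eq_abs, Real.abs_exp, Real.exp_le_exp]
  have : t ^ 2 * r ^ 2 / 2 - (-y ^ 2 / (2 * r ^ 2) + t * id y) = (y - t * r ^ 2) ^ 2 / (2 * r ^ 2) := by
    simp only [id]
    field_simp
    ring
  have h2 : 0 ≤ (y - t * r ^ 2) ^ 2 / (2 * r ^ 2) := by positivity
  linarith

lemma mem_interior_integrableExpSet_gaussWeighted (hr : 0 < r) (t : ℝ) :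
    t ∈ interior (integrableExpSet id (gaussWeighted f r)) := by
  have : integrableExpSet id (gaussWeighted f r) = Set.univ :=
    Set.eq_univ_of_forall fun t => integrable_exp_gaussWeighted hr t
  simp [this]

lemma gaussWeighted_ne_zero : gaussWeighted f r ≠ 0 := by
  intro h
  have h1 := (withDensity_eq_zero_iff (measurable_gaussWeight r).aemeasurable).1 h
  obtain ⟨y, hy⟩ := h1.exists
  simp at hy
  exact absurd hy (not_le.2 (Real.exp_pos _))

lemma mgf_gaussWeighted_pos (hr : 0 < r) (t : ℝ) : 0 < mgf id (gaussWeighted f r) t :=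
  mgf_pos' gaussWeighted_ne_zero (integrable_exp_gaussWeighted hr t)

lemma smoothedDensity_pos (hr : 0 < r) (x : ℝ) : 0 < smoothedDensity f r x := by
  rw [smoothedDensity_eq_mgf hr]
  exact mul_pos (kern_pos hr x) (mgf_gaussWeighted_pos hr _)

lemma hasDerivAt_kern (x : ℝ) : HasDerivAt (kern r) (-(x / r ^ 2) * kern r x) x := by
  have h : HasDerivAt (fun x : ℝ => (√(2 * Real.pi * r ^ 2))⁻¹ *
      Real.exp (-x ^ 2 / (2 * r ^ 2))) ((√(2 * Real.pi * r ^ 2))⁻¹ *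
      (Real.exp (-x ^ 2 / (2 * r ^ 2)) * (-(2 * x) / (2 * r ^ 2)))) x := by
    refine (HasDerivAt.exp ?_).const_mul _
    have := ((hasDerivAt_pow 2 x).neg).div_const (2 * r ^ 2)
    simpa using this
  have h2 : kern r = fun x : ℝ => (√(2 * Real.pi * r ^ 2))⁻¹ *
      Real.exp (-x ^ 2 / (2 * r ^ 2)) := funext fun x => kern_eq r x
  rw [h2]
  convert h using 1
  have : -(2 * x) / (2 * r ^ 2) = -(x / r ^ 2) := by
    rw [neg_div, mul_div_mul_left _ _ (two_ne_zero)]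
  rw [this]
  ring

lemma hasDerivAt_smoothedDensity (hr : 0 < r) (x : ℝ) :
    HasDerivAt (smoothedDensity f r)
      (((deriv (cgf id (gaussWeighted f r)) (x / r ^ 2) - x) / r ^ 2) * smoothedDensity f r x) x := by
  have h1 : HasDerivAt (fun x => mgf id (gaussWeighted f r) (x / r ^ 2))
      ((deriv (mgf id (gaussWeighted f r)) (x / r ^ 2)) * (1 / r ^ 2)) x :=
    (differentiableAt_mgf (mem_interior_integrableExpSet_gaussWeighted hr _)).hasDerivAt.comp x
      ((hasDerivAt_id x).div_const _)
  have h2 := (hasDerivAt_kern (r := r) x).mul h1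
  have h3 : smoothedDensity f r = kern r * fun x => mgf id (gaussWeighted f r) (x / r ^ 2) :=
    funext fun x => smoothedDensity_eq_mgf hr x
  rw [h3]
  refine h2.congr_deriv ?_
  have h4 := mem_interior_integrableExpSet_gaussWeighted (f := f) hr (x / r ^ 2)
  rw [deriv_cgf h4, deriv_mgf h4]
  have := (mgf_gaussWeighted_pos (f := f) hr (x / r ^ 2)).ne'
  simp only [Pi.mul_apply]
  field_simp
  ring

/-- Tweedie's formula: the derivative of the cumulant generating function is the posterior mean of
`Y` given `Y + Z = x`. -/
lemma score_eq (hr : 0 < r) (x : ℝ) :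
    score f r x = (deriv (cgf id (gaussWeighted f r)) (x / r ^ 2) - x) / r ^ 2 := by
  rw [score, logDeriv_apply, (hasDerivAt_smoothedDensity hr x).deriv,
    mul_div_assoc, div_self (smoothedDensity_pos hr x).ne', mul_one]

lemma differentiable_deriv_cgf_gaussWeighted (hr : 0 < r) :
    Differentiable ℝ (deriv (cgf id (gaussWeighted f r))) := fun t =>
  ((analyticAt_cgf (mem_interior_integrableExpSet_gaussWeighted hr t)).deriv).differentiableAt

lemma continuous_score (hr : 0 < r) : Continuous (score f r) := by
  have h := (differentiable_deriv_cgf_gaussWeighted (f := f) hr).continuous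
  have : score f r = fun x => (deriv (cgf id (gaussWeighted f r)) (x / r ^ 2) - x) / r ^ 2 :=
    funext fun x => score_eq hr x
  rw [this]
  fun_prop

/-- The second derivative of a cumulant generating function is a variance under the tilted law. -/
lemma monotone_deriv_cgf_gaussWeighted (hr : 0 < r) :
    Monotone (deriv (cgf id (gaussWeighted f r))) := by
  refine monotone_of_deriv_nonneg (differentiable_deriv_cgf_gaussWeighted hr) fun t => ?_
  have h := iteratedDeriv_two_cgf_eq_integral
    (mem_interior_integrableExpSet_gaussWeighted (f := f) hr t)
  rw [iteratedDeriv_succ, iteratedDeriv_one] at h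
  rw [h]
  exact div_nonneg (integral_nonneg fun y => by positivity) (mgf_gaussWeighted_pos hr t).le

/-- The score has one-sided Lipschitz constant `1 / r²`. -/
lemma score_sub_le (hr : 0 < r) {x y : ℝ} (hxy : x ≤ y) :
    score f r x - score f r y ≤ (y - x) / r ^ 2 := by
  rw [score_eq hr, score_eq hr, ← sub_div]
  have : deriv (cgf id (gaussWeighted f r)) (x / r ^ 2) ≤
      deriv (cgf id (gaussWeighted f r)) (y / r ^ 2) :=
    monotone_deriv_cgf_gaussWeighted hr (by gcongr)
  exact div_le_div_of_nonneg_right (by linarith) (by positivity)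

lemma integrable_kern (hr : 0 < r) (x : ℝ) : Integrable (fun y => kern r (x - y)) f := by
  have h := (integrable_mul_kern_iff (f := f) hr x 1).2
    (by simpa using integrable_exp_gaussWeighted (f := f) hr (x / r ^ 2))
  simpa using h

lemma integrable_id_mul_kern (hr : 0 < r) (x : ℝ) :
    Integrable (fun y => y * kern r (x - y)) f := by
  rw [integrable_mul_kern_iff hr x (fun y => y)]
  have := integrable_pow_mul_exp_of_mem_interior_integrableExpSet
    (mem_interior_integrableExpSet_gaussWeighted (f := f) hr (x / r ^ 2)) 1
  simpa using this

lemma integrable_exp_mul_kern (hr : 0 < r) (x t : ℝ) :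
    Integrable (fun y => Real.exp (t * y) * kern r (x - y)) f := by
  rw [integrable_mul_kern_iff hr x (fun y => Real.exp (t * y))]
  have := integrable_exp_gaussWeighted (f := f) hr (t + x / r ^ 2)
  refine this.congr (ae_of_all _ fun y => ?_)
  simp only [id]
  rw [← Real.exp_add]
  ring_nf

/-- The score is the posterior mean of `-(x - y) / r²`. -/
lemma score_mul_smoothedDensity (hr : 0 < r) (x : ℝ) :
    score f r x * smoothedDensity f r x = ∫ y, -(x - y) / r ^ 2 * kern r (x - y) ∂f := by
  have h4 := mem_interior_integrableExpSet_gaussWeighted (f := f) hr (x / r ^ 2)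
  have h5 := (mgf_gaussWeighted_pos (f := f) hr (x / r ^ 2)).ne'
  have h6 := integral_mul_kern (f := f) hr x (fun y => y)
  have e : ∀ y, -(x - y) / r ^ 2 * kern r (x - y) =
      (1 / r ^ 2) * (y * kern r (x - y)) - (x / r ^ 2) * kern r (x - y) := fun y => by ring
  simp_rw [e]
  rw [integral_sub ((integrable_id_mul_kern hr x).const_mul _) ((integrable_kern hr x).const_mul _),
    integral_const_mul, integral_const_mul, ← smoothedDensity_eq, h6, score_eq hr, deriv_cgf h4,
    smoothedDensity_eq_mgf hr]
  simp only [id]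
  generalize ∫ y, y * Real.exp (x / r ^ 2 * y) ∂(gaussWeighted f r) = A
  field_simp

/-- Jensen's inequality for the exponential of the score. -/
lemma exp_score_mul_smoothedDensity_le (hr : 0 < r) (h x : ℝ) :
    Real.exp (h * score f r x) * smoothedDensity f r x ≤
      ∫ y, Real.exp (h * (-(x - y) / r ^ 2)) * kern r (x - y) ∂f := by
  set s := score f r x with hs
  have hint : Integrable (fun y => -(x - y) / r ^ 2 * kern r (x - y)) f := by
    refine (((integrable_id_mul_kern (f := f) hr x).const_mul (1 / r ^ 2)).sub
      ((integrable_kern (f := f) hr x).const_mul (x / r ^ 2))).congr (ae_of_all _ fun y => ?_)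
    simp only [Pi.sub_apply]
    ring
  -- The right-hand integrand is the tangent line of the exponential at `h * s`; it integrates
  -- exactly to the left side because the posterior mean is `s`.
  have hlow : Real.exp (h * s) * smoothedDensity f r x =
      ∫ y, Real.exp (h * s) * ((1 - h * s) * kern r (x - y)
        + h * (-(x - y) / r ^ 2 * kern r (x - y))) ∂f := by
    rw [integral_const_mul, integral_add ((integrable_kern hr x).const_mul _) (hint.const_mul _),
      integral_const_mul, integral_const_mul, ← score_mul_smoothedDensity hr x,
      ← smoothedDensity_eq, ← hs]
    ring
  rw [hlow]
  refine integral_mono ((((integrable_kern hr x).const_mul _).add (hint.const_mul _)).const_mul _)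
    ?_ fun y => ?_
  · refine ((integrable_exp_mul_kern (f := f) hr x (h / r ^ 2)).const_mul
      (Real.exp (-(h * x) / r ^ 2))).congr (ae_of_all _ fun y => ?_)
    simp only
    rw [← mul_assoc, ← Real.exp_add]
    ring_nf
  · simp only
    set u := -(x - y) / r ^ 2
    have h1 : Real.exp (h * u) = Real.exp (h * s) * Real.exp (h * u - h * s) := by
      rw [← Real.exp_add]; ring_nf
    have h2 := Real.add_one_le_exp (h * u - h * s)
    have h3 : (1 - h * s) * kern r (x - y) + h * (u * kern r (x - y)) =
      (h * u - h * s + 1) * kern r (x - y) := by ring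
    rw [h3, h1, mul_assoc]
    gcongr
    exact kern_nonneg _ _

end

end LocationMLE

/-! ### The pair (signal, noise): sub-Gaussian score and projection identities -/

namespace LocationMLE

noncomputable section

/-- The joint law of an independent pair `(Y, Z)` with `Y ∼ f` and `Z ∼ N(0, r²)`. -/
def jointLaw (f : Measure ℝ) (r : ℝ) : Measure (ℝ × ℝ) :=
  f.prod (gaussianReal 0 (r ^ 2).toNNReal)

variable {f : Measure ℝ} {r : ℝ}

instance [IsProbabilityMeasure f] : IsProbabilityMeasure (jointLaw f r) := by
  unfold jointLaw; infer_instance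

lemma measurable_kern_sub (r : ℝ) :
    Measurable fun p : ℝ × ℝ => ENNReal.ofReal (kern r (p.2 - p.1)) :=
  ((measurable_kern r).comp (measurable_snd.sub measurable_fst)).ennreal_ofReal

lemma lintegral_jointLaw [SFinite f] (hr : 0 < r) {F : ℝ × ℝ → ENNReal} (hF : Measurable F) :
    ∫⁻ p, F p ∂(jointLaw f r) =
      ∫⁻ y, (∫⁻ x, ENNReal.ofReal (kern r (x - y)) * F (y, x - y)) ∂f := by
  rw [jointLaw, lintegral_prod _ hF.aemeasurable]
  refine lintegral_congr fun y => ?_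
  have h := lintegral_withDensity_eq_lintegral_mul volume
    (measurable_gaussianPDF 0 (r ^ 2).toNNReal) (hF.comp (measurable_prodMk_left (x := y)))
  rw [gaussianReal_of_var_ne_zero _ (toNNReal_sq_ne_zero hr)]
  refine h.trans ?_
  rw [← lintegral_sub_right_eq_self _ y]
  rfl

lemma lintegral_jointLaw_symm [SFinite f] (hr : 0 < r) {F : ℝ × ℝ → ENNReal}
    (hF : Measurable F) :
    ∫⁻ p, F p ∂(jointLaw f r) =
      ∫⁻ x, ∫⁻ y, ENNReal.ofReal (kern r (x - y)) * F (y, x - y) ∂f := by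
  rw [lintegral_jointLaw hr hF, lintegral_lintegral_swap]
  exact ((measurable_kern_sub r).mul (hF.comp (by fun_prop :
    Measurable fun p : ℝ × ℝ => (p.1, p.2 - p.1)))).aemeasurable

lemma jointLaw_eq_map [SFinite f] (hr : 0 < r) :
    jointLaw f r = ((f.prod volume).withDensity
      fun p => ENNReal.ofReal (kern r (p.2 - p.1))).map fun p => (p.1, p.2 - p.1) := by
  have hm : Measurable fun p : ℝ × ℝ => (p.1, p.2 - p.1) := by fun_prop
  refine Measure.ext_of_lintegral _ fun F hF => ?_
  have h := lintegral_withDensity_eq_lintegral_mul (f.prod volume) (measurable_kern_sub r)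
    (hF.comp hm)
  rw [lintegral_map hF hm]
  refine Eq.trans ?_ h.symm
  rw [lintegral_prod _ ((measurable_kern_sub r).mul (hF.comp hm)).aemeasurable,
    lintegral_jointLaw hr hF]
  rfl

lemma integrable_of_jointLaw [SFinite f] (hr : 0 < r) {F : ℝ × ℝ → ℝ} (hF : Measurable F)
    (h : Integrable F (jointLaw f r)) :
    Integrable (fun p : ℝ × ℝ => kern r (p.2 - p.1) * F (p.1, p.2 - p.1)) (f.prod volume) := by
  have hm : Measurable fun p : ℝ × ℝ => (p.1, p.2 - p.1) := by fun_prop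
  rw [jointLaw_eq_map hr, integrable_map_measure hF.aestronglyMeasurable hm.aemeasurable,
    integrable_withDensity_iff_integrable_smul' (measurable_kern_sub r) (by simp)] at h
  simpa [ENNReal.toReal_ofReal, kern_nonneg] using h

/-- Integrating out the noise: the pair `(Y, Y + Z)` has density `kern r (x - y)`. -/
lemma integral_jointLaw [SFinite f] (hr : 0 < r) {F : ℝ × ℝ → ℝ} (hF : Measurable F)
    (h : Integrable F (jointLaw f r)) :
    ∫ p, F p ∂(jointLaw f r) = ∫ x, ∫ y, kern r (x - y) * F (y, x - y) ∂f := by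
  have hm : Measurable fun p : ℝ × ℝ => (p.1, p.2 - p.1) := by fun_prop
  have h' := integrable_of_jointLaw hr hF h
  rw [jointLaw_eq_map hr, integral_map hm.aemeasurable hF.aestronglyMeasurable,
    integral_withDensity_eq_integral_toReal_smul (measurable_kern_sub r) (by simp)]
  simp only [ENNReal.toReal_ofReal (kern_nonneg _ _), smul_eq_mul]
  rw [integral_prod_symm _ h']

variable [IsProbabilityMeasure f]

lemma measurable_score (hr : 0 < r) : Measurable (score f r) := (continuous_score hr).measurable

/-- Against a function of `Y + Z` alone, `-Z / r²` may be replaced by its conditional expectation,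
which is the score. -/
lemma integral_noise_mul (hr : 0 < r) {g : ℝ → ℝ} (hg : Measurable g)
    (h1 : Integrable (fun p : ℝ × ℝ => -p.2 / r ^ 2 * g (p.1 + p.2)) (jointLaw f r))
    (h2 : Integrable (fun p : ℝ × ℝ => score f r (p.1 + p.2) * g (p.1 + p.2)) (jointLaw f r)) :
    ∫ p, -p.2 / r ^ 2 * g (p.1 + p.2) ∂(jointLaw f r) =
      ∫ p, score f r (p.1 + p.2) * g (p.1 + p.2) ∂(jointLaw f r) := by
  have hs := measurable_score (f := f) hr
  rw [integral_jointLaw hr (by fun_prop) h1, integral_jointLaw hr (by fun_prop) h2]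
  refine integral_congr_ae (ae_of_all _ fun x => ?_)
  have e1 : ∀ y, kern r (x - y) * (-(x - y) / r ^ 2 * g (y + (x - y))) =
    g x * (-(x - y) / r ^ 2 * kern r (x - y)) := fun y => by
      rw [add_sub_cancel]; ring
  have e2 : ∀ y, kern r (x - y) * (score f r (y + (x - y)) * g (y + (x - y))) =
    score f r x * g x * kern r (x - y) := fun y => by
      rw [add_sub_cancel]; ring
  simp only [e1, e2]
  rw [integral_const_mul, integral_const_mul, ← score_mul_smoothedDensity hr x,
    ← smoothedDensity_eq]
  ring

/-- Jensen's inequality integrated over `x`. Lower integrals are used because integrability of the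
left side is a consequence, not yet known. -/
lemma lintegral_exp_score_le (hr : 0 < r) (h : ℝ) :
    ∫⁻ p, ENNReal.ofReal (Real.exp (h * score f r (p.1 + p.2))) ∂(jointLaw f r) ≤
      ∫⁻ p, ENNReal.ofReal (Real.exp (h * (-p.2 / r ^ 2))) ∂(jointLaw f r) := by
  have hs := measurable_score (f := f) hr
  rw [lintegral_jointLaw_symm hr (by fun_prop), lintegral_jointLaw_symm hr (by fun_prop)]
  refine lintegral_mono fun x => ?_
  simp only [add_sub_cancel]
  simp_rw [← ENNReal.ofReal_mul (kern_nonneg _ _)]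
  have hint : Integrable (fun y => Real.exp (h * (-(x - y) / r ^ 2)) * kern r (x - y)) f := by
    refine ((integrable_exp_mul_kern (f := f) hr x (h / r ^ 2)).const_mul
      (Real.exp (-(h * x) / r ^ 2))).congr (ae_of_all _ fun y => ?_)
    simp only
    rw [← mul_assoc, ← Real.exp_add]
    ring_nf
  rw [← ofReal_integral_eq_lintegral_ofReal ((integrable_kern hr x).mul_const _)
      (ae_of_all _ fun y => mul_nonneg (kern_nonneg _ _) (Real.exp_nonneg _)),
    ← ofReal_integral_eq_lintegral_ofReal (by simpa only [mul_comm] using hint)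
      (ae_of_all _ fun y => mul_nonneg (kern_nonneg _ _) (Real.exp_nonneg _))]
  refine ENNReal.ofReal_le_ofReal ?_
  have := exp_score_mul_smoothedDensity_le (f := f) hr h x
  rw [integral_mul_const, ← smoothedDensity_eq]
  simpa only [mul_comm] using this

lemma map_neg_noise_div (hr : 0 < r) :
    (jointLaw f r).map (fun p => -p.2 / r) = gaussianReal 0 1 := by
  have h1 : (fun p : ℝ × ℝ => -p.2 / r) = (fun z => -z / r) ∘ Prod.snd := rfl
  rw [h1, ← Measure.map_map (by fun_prop) (by fun_prop), jointLaw]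
  have h2 : (f.prod (gaussianReal 0 (r ^ 2).toNNReal)).map Prod.snd
      = gaussianReal 0 (r ^ 2).toNNReal := by
    change (f.prod (gaussianReal 0 (r ^ 2).toNNReal)).snd = _
    simp
  have h3 : (fun z : ℝ => -z / r) = fun z => (-1 / r) * z := by ext z; ring
  rw [h2, h3, gaussianReal_map_const_mul]
  congr 1
  · simp
  · ext
    simp only [NNReal.coe_mul, NNReal.coe_mk, coe_toNNReal_sq, NNReal.coe_one]
    field_simp

lemma integrable_exp_noise (hr : 0 < r) (t : ℝ) :
    Integrable (fun p : ℝ × ℝ => Real.exp (t * (-p.2 / r))) (jointLaw f r) := by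
  have := integrable_exp_mul_gaussianReal (μ := 0) (v := 1) t
  rw [← map_neg_noise_div (f := f) hr, integrable_map_measure (by fun_prop) (by fun_prop)] at this
  exact this

lemma mgf_noise (hr : 0 < r) (t : ℝ) :
    mgf (fun p : ℝ × ℝ => -p.2 / r) (jointLaw f r) t = Real.exp (t ^ 2 / 2) := by
  rw [mgf_gaussianReal (map_neg_noise_div hr)]
  simp

lemma hasSubgaussianMGF_noise (hr : 0 < r) :
    HasSubgaussianMGF (fun p : ℝ × ℝ => -p.2 / r) 1 (jointLaw f r) where
  integrable_exp_mul := integrable_exp_noise hr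
  mgf_le t := by rw [mgf_noise hr]; simp

/-- The normalised score is sub-Gaussian with variance proxy one. -/
lemma hasSubgaussianMGF_score (hr : 0 < r) :
    HasSubgaussianMGF (fun p : ℝ × ℝ => r * score f r (p.1 + p.2)) 1 (jointLaw f r) := by
  have hs := measurable_score (f := f) hr
  have key : ∀ t : ℝ, ∫⁻ p, ENNReal.ofReal (Real.exp (t * (r * score f r (p.1 + p.2))))
      ∂(jointLaw f r) ≤ ENNReal.ofReal (Real.exp (t ^ 2 / 2)) := fun t => by
    have h1 := lintegral_exp_score_le (f := f) hr (t * r)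
    have h2 : ∀ p : ℝ × ℝ, t * r * (-p.2 / r ^ 2) = t * (-p.2 / r) := fun p => by
      field_simp
    simp_rw [h2, mul_assoc] at h1
    refine h1.trans_eq ?_
    rw [← ofReal_integral_eq_lintegral_ofReal (integrable_exp_noise hr t)
      (ae_of_all _ fun _ => Real.exp_nonneg _)]
    congr 1
    exact mgf_noise hr t
  have hint : ∀ t : ℝ, Integrable
      (fun p : ℝ × ℝ => Real.exp (t * (r * score f r (p.1 + p.2)))) (jointLaw f r) := fun t => by
    refine ⟨Measurable.aestronglyMeasurable (by fun_prop), ?_⟩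
    rw [hasFiniteIntegral_iff_ofReal (ae_of_all _ fun _ => Real.exp_nonneg _)]
    exact (key t).trans_lt ENNReal.ofReal_lt_top
  refine ⟨hint, fun t => ?_⟩
  have h := key t
  rw [← ofReal_integral_eq_lintegral_ofReal (hint t) (ae_of_all _ fun _ => Real.exp_nonneg _),
    ENNReal.ofReal_le_ofReal_iff (Real.exp_nonneg _)] at h
  simpa [mgf] using h

lemma memLp_score (hr : 0 < r) (q : NNReal) :
    MemLp (fun p : ℝ × ℝ => score f r (p.1 + p.2)) q (jointLaw f r) := by
  have := ((hasSubgaussianMGF_score (f := f) hr).memLp q).const_mul r⁻¹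
  simpa [← mul_assoc, hr.ne'] using this

lemma memLp_noise (hr : 0 < r) (q : NNReal) :
    MemLp (fun p : ℝ × ℝ => -p.2 / r ^ 2) q (jointLaw f r) := by
  have := ((hasSubgaussianMGF_noise (f := f) hr).memLp q).const_mul r⁻¹
  refine this.ae_eq (ae_of_all _ fun p => ?_)
  simp only
  field_simp

lemma fisherInfo_eq (hr : 0 < r) :
    fisherInfo f r = ∫ p, score f r (p.1 + p.2) ^ 2 ∂(jointLaw f r) := by
  have hs := measurable_score (f := f) hr
  rw [integral_jointLaw hr (by fun_prop) ((memLp_score hr 2).integrable_sq), fisherInfo]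
  refine integral_congr_ae (ae_of_all _ fun x => ?_)
  simp only [add_sub_cancel]
  rw [integral_mul_const, ← smoothedDensity_eq, mul_comm]

lemma integral_score (hr : 0 < r) : ∫ p, score f r (p.1 + p.2) ∂(jointLaw f r) = 0 := by
  have h1 : Integrable (fun p : ℝ × ℝ => -p.2 / r ^ 2) (jointLaw f r) :=
    (memLp_noise hr 1).integrable le_rfl
  have h2 : Integrable (fun p : ℝ × ℝ => score f r (p.1 + p.2)) (jointLaw f r) :=
    (memLp_score hr 1).integrable le_rfl
  have h := integral_noise_mul (f := f) hr (g := fun _ => 1) measurable_const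
    (by simpa using h1) (by simpa using h2)
  simp only [mul_one] at h
  rw [← h, jointLaw, integral_fun_snd (fun z => -z / r ^ 2), integral_div, integral_neg]
  simp

/-- The projection identity with `g` the score itself. Equality of this covariance with the variance
of the score is what fixes the coefficient `-1/2` of `ε² I` later. -/
lemma integral_noise_mul_score (hr : 0 < r) :
    ∫ p, -p.2 / r ^ 2 * score f r (p.1 + p.2) ∂(jointLaw f r) = fisherInfo f r := by
  have h := integral_noise_mul (f := f) hr (measurable_score (f := f) hr)
    (MemLp.integrable_mul (p := 2) (q := 2) (memLp_noise hr 2) (memLp_score hr 2))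
    (MemLp.integrable_mul (p := 2) (q := 2) (memLp_score hr 2) (memLp_score hr 2))
  rw [h, fisherInfo_eq hr]
  simp_rw [pow_two]

end

end LocationMLE

/-! ### Exponential moment of the shifted score -/

namespace LocationMLE

noncomputable section

lemma abs_exp_sub_sum_le (x : ℝ) (n : ℕ) :
    |Real.exp x - ∑ m ∈ Finset.range n, x ^ m / m.factorial| ≤ |x| ^ n * Real.exp |x| := by
  have h := Complex.norm_exp_sub_sum_le_norm_mul_exp (x : ℂ) n
  have e : Complex.exp (x : ℂ) - ∑ m ∈ Finset.range n, (x : ℂ) ^ m / m.factorial =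
      ((Real.exp x - ∑ m ∈ Finset.range n, x ^ m / m.factorial : ℝ) : ℂ) := by
    push_cast; rfl
  rw [e, Complex.norm_real, Complex.norm_real] at h
  exact h

lemma abs_exp_sub_one_le_mul_exp (x : ℝ) : |Real.exp x - 1| ≤ |x| * Real.exp |x| := by
  simpa using abs_exp_sub_sum_le x 1

lemma abs_exp_sub_one_sub_le_mul_exp (x : ℝ) :
    |Real.exp x - 1 - x| ≤ |x| ^ 2 * Real.exp |x| := by
  have := abs_exp_sub_sum_le x 2
  simpa [Finset.sum_range_succ, ← sub_sub] using this

lemma exp_le_quadratic_add (x : ℝ) :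
    Real.exp x ≤ 1 + x + x ^ 2 / 2 + |x| ^ 3 * Real.exp |x| := by
  have := (le_abs_self _).trans (abs_exp_sub_sum_le x 3)
  simp [Finset.sum_range_succ, Nat.factorial] at this
  linarith

lemma le_exp_self (x : ℝ) : x ≤ Real.exp x := by
  linarith [Real.add_one_le_exp x]

/-- Third-order expansion of the tilted exponential `exp (e u - e² / 2) * exp (-e s)`. -/
lemma tilt_mul_exp_le {e : ℝ} (he : |e| ≤ 1) (u s : ℝ) :
    Real.exp (e * u - e ^ 2 / 2) * Real.exp (-(e * s)) ≤
      Real.exp (e * u - e ^ 2 / 2) - e * s - e ^ 2 * (u * s) + e ^ 2 / 2 * s ^ 2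
        + 4 * |e| ^ 3 * (|s| * Real.exp (3 * (|u| + 1 + |s|))) := by
  set v := e * u - e ^ 2 / 2 with hv
  set A := |u| + 1 with hA
  set G := Real.exp v with hG
  set E := Real.exp A with hE
  set F := Real.exp |s| with hF
  have he0 := abs_nonneg e
  have he2 : |e| ^ 2 = e ^ 2 := sq_abs e
  have hA1 : 1 ≤ A := by rw [hA]; linarith [abs_nonneg u]
  have hE1 : 1 ≤ E := Real.one_le_exp (by linarith)
  have hAE : A ≤ E := le_exp_self A
  have hF1 : 1 ≤ F := Real.one_le_exp (abs_nonneg s)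
  have hsF : |s| ≤ F := le_exp_self _
  have hvA : |v| ≤ |e| * A := by
    calc |v| ≤ |e * u| + |e ^ 2 / 2| := abs_sub _ _
      _ = |e| * |u| + |e| ^ 2 / 2 := by rw [abs_mul, abs_of_nonneg (by positivity : 0 ≤ e ^ 2 / 2), he2]
      _ ≤ |e| * A := by rw [hA]; nlinarith
  have hvA' : |v| ≤ A := hvA.trans (by nlinarith)
  have hevE : Real.exp |v| ≤ E := Real.exp_le_exp.2 hvA'
  have hGE : G ≤ E := Real.exp_le_exp.2 ((le_abs_self v).trans hvA')
  have hG0 : 0 ≤ G := Real.exp_nonneg v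
  -- The term of `exp (-(e s))` without `s` keeps `G` exact, since its mean is 1. Against `e s` the
  -- expansion of `G` must be right to first order, against `e² s²` to order zero, and against the
  -- cubic remainder a bound on `G` is enough.
  have hG1 : |G - 1| ≤ |e| * E ^ 2 := by
    calc |G - 1| ≤ |v| * Real.exp |v| := abs_exp_sub_one_le_mul_exp v
      _ ≤ (|e| * E) * E := by gcongr; exact hvA.trans (by gcongr)
      _ = _ := by ring
  have hG2 : |G - 1 - e * u| ≤ 2 * |e| ^ 2 * E ^ 3 := by
    have h1 : |G - 1 - v| ≤ (|e| * E) ^ 2 * E :=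
      (abs_exp_sub_one_sub_le_mul_exp v).trans (by gcongr; exact hvA.trans (by gcongr))
    have h2 : G - 1 - e * u = (G - 1 - v) + (-(e ^ 2 / 2)) := by rw [hv]; ring
    have h3 : |-(e ^ 2 / 2)| ≤ |e| ^ 2 * E ^ 3 := by
      rw [abs_neg, abs_of_nonneg (by positivity), he2]
      have : 1 ≤ E ^ 3 := one_le_pow₀ hE1
      nlinarith [sq_nonneg e]
    rw [h2]
    refine (abs_add_le _ _).trans ?_
    nlinarith
  have hexp : Real.exp (3 * (|u| + 1 + |s|)) = E ^ 3 * F ^ 3 := by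
    rw [hE, hF, ← Real.exp_nat_mul, ← Real.exp_nat_mul, ← Real.exp_add]
    congr 1
    push_cast
    ring
  have hmain : Real.exp (-(e * s)) ≤ 1 - e * s + e ^ 2 * s ^ 2 / 2 + |e| ^ 3 * |s| * F ^ 3 := by
    have h1 := exp_le_quadratic_add (-(e * s))
    have h2 : |(-(e * s))| = |e| * |s| := by rw [abs_neg, abs_mul]
    rw [h2] at h1
    have h3 : (|e| * |s|) ^ 3 * Real.exp (|e| * |s|) ≤ |e| ^ 3 * |s| * F ^ 3 := by
      have h4 : Real.exp (|e| * |s|) ≤ F :=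
        Real.exp_le_exp.2 (mul_le_of_le_one_left (abs_nonneg s) he)
      calc (|e| * |s|) ^ 3 * Real.exp (|e| * |s|) = |e| ^ 3 * |s| * (|s| * |s| * Real.exp (|e| * |s|)) := by ring
        _ ≤ |e| ^ 3 * |s| * (F * F * F) := by gcongr
        _ = _ := by ring
    nlinarith
  have hstep : G * Real.exp (-(e * s)) ≤
      G * (1 - e * s + e ^ 2 * s ^ 2 / 2 + |e| ^ 3 * |s| * F ^ 3) := by gcongr
  refine hstep.trans ?_
  rw [hexp]
  have hEF : ∀ i j : ℕ, i ≤ 3 → j ≤ 3 → E ^ i * F ^ j ≤ E ^ 3 * F ^ 3 := fun i j hi hj =>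
    mul_le_mul (pow_le_pow_right₀ hE1 hi) (pow_le_pow_right₀ hF1 hj) (by positivity) (by positivity)
  have t1 : -(e * (G - 1 - e * u) * s) ≤ 2 * (|e| ^ 3 * |s| * (E ^ 3 * F ^ 3)) := by
    calc -(e * (G - 1 - e * u) * s) ≤ |e * (G - 1 - e * u) * s| := neg_le_abs _
      _ = |e| * |G - 1 - e * u| * |s| := by rw [abs_mul, abs_mul]
      _ ≤ |e| * (2 * |e| ^ 2 * E ^ 3) * |s| := by gcongr
      _ = 2 * (|e| ^ 3 * |s| * (E ^ 3 * F ^ 0)) := by ring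
      _ ≤ _ := by gcongr ?_ * (?_ * ?_); exact hEF 3 0 le_rfl (by norm_num)
  have t2 : (G - 1) * (e ^ 2 * s ^ 2 / 2) ≤ 1 * (|e| ^ 3 * |s| * (E ^ 3 * F ^ 3)) := by
    calc (G - 1) * (e ^ 2 * s ^ 2 / 2) ≤ |e| * E ^ 2 * (e ^ 2 * s ^ 2 / 2) := by
          gcongr; exact (le_abs_self _).trans hG1
      _ = |e| ^ 3 * |s| * (E ^ 2 * |s|) / 2 := by rw [← he2, ← sq_abs s]; ring
      _ ≤ |e| ^ 3 * |s| * (E ^ 2 * F) / 2 := by gcongr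
      _ ≤ |e| ^ 3 * |s| * (E ^ 2 * F) := half_le_self (by positivity)
      _ = |e| ^ 3 * |s| * (E ^ 2 * F ^ 1) := by ring
      _ ≤ _ := by
        rw [one_mul]
        gcongr ?_ * ?_
        exact hEF 2 1 (by norm_num) (by norm_num)
  have t3 : G * (|e| ^ 3 * |s| * F ^ 3) ≤ 1 * (|e| ^ 3 * |s| * (E ^ 3 * F ^ 3)) := by
    calc G * (|e| ^ 3 * |s| * F ^ 3) ≤ E * (|e| ^ 3 * |s| * F ^ 3) := by gcongr
      _ = |e| ^ 3 * |s| * (E ^ 1 * F ^ 3) := by ring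
      _ ≤ _ := by
        rw [one_mul]
        gcongr ?_ * ?_
        exact hEF 1 3 (by norm_num) le_rfl
  linear_combination t1 + t2 + t3

section tilt

variable {Ω : Type*} {mΩ : MeasurableSpace Ω} {μ : Measure Ω}

lemma integral_exp_mul_abs_le {X : Ω → ℝ} (hX : HasSubgaussianMGF X 1 μ) (t : ℝ) :
    ∫ ω, Real.exp (t * |X ω|) ∂μ ≤ 2 * Real.exp (t ^ 2 / 2) := by
  have h1 := hX.mgf_le t
  have h2 := hX.mgf_le (-t)
  simp only [mgf, NNReal.coe_one, one_mul, even_two.neg_pow] at h1 h2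
  calc ∫ ω, Real.exp (t * |X ω|) ∂μ ≤
      ∫ ω, (Real.exp (t * X ω) + Real.exp (-t * X ω)) ∂μ := by
        refine integral_mono_of_nonneg (ae_of_all _ fun _ => Real.exp_nonneg _)
          ((hX.integrable_exp_mul t).add (hX.integrable_exp_mul (-t))) (ae_of_all _ fun ω => ?_)
        have := Real.exp_pos (t * X ω)
        have := Real.exp_pos (-t * X ω)
        rcases abs_cases (X ω) with ⟨h, _⟩ | ⟨h, _⟩ <;> simp only [h]
        · linarith
        · rw [mul_neg, ← neg_mul]; linarith
    _ ≤ _ := by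
        rw [integral_add (hX.integrable_exp_mul t) (hX.integrable_exp_mul (-t))]
        linarith

lemma integral_mul_le_sqrt_mul_sqrt {X Y : Ω → ℝ} (hX0 : 0 ≤ X) (hY0 : 0 ≤ Y)
    (hX : MemLp X 2 μ) (hY : MemLp Y 2 μ) :
    ∫ ω, X ω * Y ω ∂μ ≤ √(∫ ω, X ω ^ 2 ∂μ) * √(∫ ω, Y ω ^ 2 ∂μ) := by
  have := integral_mul_le_Lp_mul_Lq_of_nonneg Real.HolderConjugate.two_two
    (ae_of_all μ hX0) (ae_of_all μ hY0) (by simpa using hX) (by simpa using hY)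
  simpa [Real.sqrt_eq_rpow] using this

/-- Taking expectations, the linear term vanishes and the quadratic ones combine to `-e² J + e² J /
2`. Cauchy–Schwarz on the remainder preserves a factor `√J`, which keeps it comparable with `e² J`
even when the variance `J` is small. -/
lemma integral_tilt_mul_exp_le [IsProbabilityMeasure μ] {U S : Ω → ℝ} (hU : HasSubgaussianMGF U 1 μ)
    (hS : HasSubgaussianMGF S 1 μ) {e : ℝ} (he : |e| ≤ 1)
    (hmgf : mgf U μ e = Real.exp (e ^ 2 / 2)) (hS0 : ∫ ω, S ω ∂μ = 0)
    (hUS : ∫ ω, U ω * S ω ∂μ = ∫ ω, S ω ^ 2 ∂μ) :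
    ∫ ω, Real.exp (e * U ω - e ^ 2 / 2) * Real.exp (-(e * S ω)) ∂μ ≤
      1 - e ^ 2 * (∫ ω, S ω ^ 2 ∂μ) / 2 + 8 * Real.exp 39 * |e| ^ 3 * √(∫ ω, S ω ^ 2 ∂μ) := by
  set J := ∫ ω, S ω ^ 2 ∂μ with hJ
  have hUm := hU.aemeasurable
  have hSm := hS.aemeasurable
  set H : Ω → ℝ := fun ω => Real.exp (3 * (|U ω| + 1 + |S ω|)) with hH
  have hHm : AEStronglyMeasurable H μ :=
    (Real.measurable_exp.comp_aemeasurable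
      (((hUm.norm.add_const 1).add hSm.norm).const_mul 3)).aestronglyMeasurable
  have hHsq : ∀ ω, H ω ^ 2 ≤
      Real.exp 6 * ((Real.exp (12 * |U ω|) + Real.exp (12 * |S ω|)) / 2) := fun ω => by
    have h1 : H ω ^ 2 = Real.exp 6 * (Real.exp (6 * |U ω|) * Real.exp (6 * |S ω|)) := by
      rw [hH, ← Real.exp_nat_mul, ← Real.exp_add, ← Real.exp_add]
      congr 1
      push_cast
      ring
    have h2 : ∀ x : ℝ, Real.exp (12 * x) = Real.exp (6 * x) ^ 2 := fun x => by
      rw [← Real.exp_nat_mul]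
      congr 1
      push_cast
      ring
    rw [h1, h2, h2]
    gcongr
    nlinarith [sq_nonneg (Real.exp (6 * |U ω|) - Real.exp (6 * |S ω|))]
  have iU : Integrable (fun ω => Real.exp (12 * |U ω|)) μ :=
    integrable_exp_mul_abs (hU.integrable_exp_mul 12) (hU.integrable_exp_mul (-12))
  have iS : Integrable (fun ω => Real.exp (12 * |S ω|)) μ :=
    integrable_exp_mul_abs (hS.integrable_exp_mul 12) (hS.integrable_exp_mul (-12))
  have iB := (((iU.add iS).div_const 2).const_mul (Real.exp 6))
  have hHL : MemLp H 2 μ := by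
    rw [memLp_two_iff_integrable_sq hHm]
    refine iB.mono' (hHm.pow 2) (ae_of_all _ fun ω => ?_)
    rw [Real.norm_eq_abs, abs_of_nonneg (sq_nonneg _)]
    exact hHsq ω
  have hSL : MemLp S 2 μ := hS.memLp 2
  have hUL : MemLp U 2 μ := hU.memLp 2
  have hSabs : MemLp (fun ω => |S ω|) 2 μ := hSL.norm
  have hEH : ∫ ω, H ω ^ 2 ∂μ ≤ 2 * Real.exp 78 := by
    calc ∫ ω, H ω ^ 2 ∂μ ≤
        ∫ ω, Real.exp 6 * ((Real.exp (12 * |U ω|) + Real.exp (12 * |S ω|)) / 2) ∂μ :=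
          integral_mono hHL.integrable_sq iB hHsq
      _ = Real.exp 6 * ((∫ ω, Real.exp (12 * |U ω|) ∂μ + ∫ ω, Real.exp (12 * |S ω|) ∂μ) / 2) := by
          rw [integral_const_mul, integral_div, integral_add iU iS]
      _ ≤ Real.exp 6 * ((2 * Real.exp (12 ^ 2 / 2) + 2 * Real.exp (12 ^ 2 / 2)) / 2) := by
          gcongr
          · exact integral_exp_mul_abs_le hU 12
          · exact integral_exp_mul_abs_le hS 12
      _ = 2 * Real.exp 78 := by
          have : Real.exp 78 = Real.exp 6 * Real.exp (12 ^ 2 / 2) := by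
            rw [← Real.exp_add]; norm_num
          rw [this]; ring
  -- The exponent is `39 = (6 + 12² / 2) / 2`: 6 from the constant in `H ^ 2`, `12² / 2` from the
  -- sub-Gaussian moments, halved by the square root.
  have hsqrtH : √(∫ ω, H ω ^ 2 ∂μ) ≤ 2 * Real.exp 39 := by
    rw [Real.sqrt_le_left (by positivity)]
    refine hEH.trans ?_
    have : Real.exp 78 = Real.exp 39 ^ 2 := by
      rw [← Real.exp_nat_mul]; norm_num
    rw [this]
    nlinarith [sq_nonneg (Real.exp 39)]
  have hSH : ∫ ω, |S ω| * H ω ∂μ ≤ √J * (2 * Real.exp 39) := by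
    refine (integral_mul_le_sqrt_mul_sqrt (fun ω => abs_nonneg _) (fun ω => Real.exp_nonneg _)
      hSabs hHL).trans ?_
    simp_rw [sq_abs]
    gcongr
  have iSH : Integrable (fun ω => |S ω| * H ω) μ := hSabs.integrable_mul hHL
  have iUS : Integrable (fun ω => U ω * S ω) μ := hUL.integrable_mul hSL
  have iS1 : Integrable S μ := hS.integrable
  have iSsq : Integrable (fun ω => S ω ^ 2) μ := hSL.integrable_sq
  have hGeq : ∀ ω, Real.exp (e * U ω - e ^ 2 / 2) =
      Real.exp (e * U ω) * Real.exp (-(e ^ 2 / 2)) := fun ω => by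
    rw [← Real.exp_add, sub_eq_add_neg]
  have iG : Integrable (fun ω => Real.exp (e * U ω - e ^ 2 / 2)) μ := by
    simp_rw [hGeq]
    exact (hU.integrable_exp_mul e).mul_const _
  have hG : ∫ ω, Real.exp (e * U ω - e ^ 2 / 2) ∂μ = 1 := by
    simp_rw [hGeq]
    rw [integral_mul_const]
    change mgf U μ e * _ = 1
    rw [hmgf, ← Real.exp_add, add_neg_cancel, Real.exp_zero]
  have i1 := iG.sub (iS1.const_mul e)
  have i2 := i1.sub (iUS.const_mul (e ^ 2))
  have i3 := i2.add (iSsq.const_mul (e ^ 2 / 2))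
  have i4 := iSH.const_mul (4 * |e| ^ 3)
  calc ∫ ω, Real.exp (e * U ω - e ^ 2 / 2) * Real.exp (-(e * S ω)) ∂μ
      ≤ ∫ ω, (Real.exp (e * U ω - e ^ 2 / 2) - e * S ω - e ^ 2 * (U ω * S ω)
          + e ^ 2 / 2 * S ω ^ 2 + 4 * |e| ^ 3 * (|S ω| * H ω)) ∂μ :=
        integral_mono_of_nonneg (ae_of_all _ fun _ => by positivity) (i3.add i4)
          (ae_of_all _ fun ω => tilt_mul_exp_le he (U ω) (S ω))
    _ = 1 - e * 0 - e ^ 2 * J + e ^ 2 / 2 * J + 4 * |e| ^ 3 * ∫ ω, |S ω| * H ω ∂μ := by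
        rw [← hUS, ← hS0, ← hG]
        refine (integral_add i3 i4).trans ?_
        rw [integral_const_mul]
        congr 1
        refine (integral_add i2 (iSsq.const_mul (e ^ 2 / 2))).trans ?_
        rw [integral_const_mul, ← hJ, ← hUS]
        congr 1
        refine (integral_sub i1 (iUS.const_mul (e ^ 2))).trans ?_
        rw [integral_const_mul]
        congr 1
        refine (integral_sub iG (iS1.const_mul e)).trans ?_
        rw [integral_const_mul]
    _ ≤ 1 - e * 0 - e ^ 2 * J + e ^ 2 / 2 * J + 4 * |e| ^ 3 * (√J * (2 * Real.exp 39)) := by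
        gcongr
    _ = _ := by ring

end tilt

variable {f : Measure ℝ} {r : ℝ} [IsProbabilityMeasure f]

/-- The absolute constant in the expansion of the exponential moment of the shifted score. -/
def scoreConst : ℝ := 8 * Real.exp 39

lemma scoreConst_pos : 0 < scoreConst := by unfold scoreConst; positivity

lemma fisherInfo_nonneg (hr : 0 < r) : 0 ≤ fisherInfo f r := by
  rw [fisherInfo_eq hr]
  exact integral_nonneg fun _ => sq_nonneg _

/-- Translating the noise amounts to tilting its law. -/
lemma map_shift_jointLaw (hr : 0 < r) (ε : ℝ) :
    (jointLaw f r).map (fun p => (p.1, p.2 - ε)) = (jointLaw f r).withDensity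
      fun p => ENNReal.ofReal (Real.exp (ε / r * (-p.2 / r) - (ε / r) ^ 2 / 2)) := by
  have hm : Measurable fun p : ℝ × ℝ => (p.1, p.2 - ε) := by fun_prop
  have hG : Measurable fun p : ℝ × ℝ =>
      ENNReal.ofReal (Real.exp (ε / r * (-p.2 / r) - (ε / r) ^ 2 / 2)) := by fun_prop
  refine Measure.ext_of_lintegral _ fun F hF => ?_
  rw [lintegral_map hF hm, lintegral_withDensity_eq_lintegral_mul _ hG hF,
    lintegral_jointLaw hr (F := fun p => F (p.1, p.2 - ε)) (hF.comp hm),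
    lintegral_jointLaw hr (hG.mul hF)]
  refine lintegral_congr fun y => ?_
  rw [← lintegral_add_right_eq_self _ ε]
  refine lintegral_congr fun x => ?_
  simp only [Pi.mul_apply]
  rw [← mul_assoc, ← ENNReal.ofReal_mul (kern_nonneg _ _), show x + ε - y = (x - y) + ε by ring,
    kern_add, add_sub_cancel_right]
  congr 4
  ring

/-- After tilting, the integrand is a product of two exponentials that are square integrable by
sub-Gaussianity. -/
lemma integrable_exp_shifted_score (hr : 0 < r) (ε t : ℝ) :
    Integrable (fun p : ℝ × ℝ => Real.exp (t * score f r (p.1 + p.2 - ε))) (jointLaw f r) := by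
  have hs := measurable_score (f := f) hr
  have hm : Measurable fun p : ℝ × ℝ => (p.1, p.2 - ε) := by fun_prop
  have h : Integrable (fun p : ℝ × ℝ => Real.exp (t * score f r (p.1 + p.2)))
      ((jointLaw f r).map (fun p => (p.1, p.2 - ε))) := by
    rw [map_shift_jointLaw hr, integrable_withDensity_iff_integrable_smul' (by fun_prop) (by simp)]
    simp only [ENNReal.toReal_ofReal (Real.exp_nonneg _), smul_eq_mul]
    have hU : MemLp (fun p : ℝ × ℝ => Real.exp (ε / r * (-p.2 / r) - (ε / r) ^ 2 / 2)) 2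
        (jointLaw f r) := by
      rw [memLp_two_iff_integrable_sq (Measurable.aestronglyMeasurable (by fun_prop))]
      refine ((integrable_exp_noise (f := f) hr (2 * (ε / r))).mul_const
        (Real.exp (-(ε / r) ^ 2))).congr (ae_of_all _ fun p => ?_)
      simp only
      rw [← Real.exp_nat_mul, ← Real.exp_add]
      congr 1
      push_cast
      ring
    have hS : MemLp (fun p : ℝ × ℝ => Real.exp (t * score f r (p.1 + p.2))) 2
        (jointLaw f r) := by
      rw [memLp_two_iff_integrable_sq (Measurable.aestronglyMeasurable (by fun_prop))]
      refine ((hasSubgaussianMGF_score (f := f) hr).integrable_exp_mul (2 * t / r)).congr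
        (ae_of_all _ fun p => ?_)
      simp only
      rw [← Real.exp_nat_mul]
      congr 1
      push_cast
      field_simp
    exact hU.integrable_mul hS
  rw [integrable_map_measure (Measurable.aestronglyMeasurable (by fun_prop)) hm.aemeasurable] at h
  refine h.congr (ae_of_all _ fun p => ?_)
  simp only [Function.comp_apply, add_sub_assoc]

/-- The exponential moment of the shifted score, to third order in the shift. -/
lemma integral_exp_shifted_score_le (hr : 0 < r) {ε : ℝ} (hε : |ε| ≤ r) :
    ∫ p, Real.exp (-ε * score f r (p.1 + p.2 - ε)) ∂(jointLaw f r) ≤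
      1 - ε ^ 2 * fisherInfo f r / 2
        + scoreConst * |ε| ^ 3 * √(fisherInfo f r) / r ^ 2 := by
  have hs := measurable_score (f := f) hr
  have hm : Measurable fun p : ℝ × ℝ => (p.1, p.2 - ε) := by fun_prop
  have he : |ε / r| ≤ 1 := by
    rw [abs_div, abs_of_pos hr]
    exact (div_le_one hr).2 hε
  have hJ : ∫ p, (r * score f r (p.1 + p.2)) ^ 2 ∂(jointLaw f r) = r ^ 2 * fisherInfo f r := by
    simp_rw [mul_pow]
    rw [integral_const_mul, fisherInfo_eq hr]
  have h := integral_tilt_mul_exp_le (hasSubgaussianMGF_noise (f := f) hr)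
    (hasSubgaussianMGF_score (f := f) hr) he (mgf_noise hr _)
    (by rw [integral_const_mul, integral_score hr, mul_zero])
    (by
      rw [hJ, ← integral_noise_mul_score hr, ← integral_const_mul]
      refine integral_congr_ae (ae_of_all _ fun p => ?_)
      simp only
      field_simp)
  rw [hJ] at h
  have e1 : ∫ p, Real.exp (-ε * score f r (p.1 + p.2 - ε)) ∂(jointLaw f r) =
      ∫ p, Real.exp (-ε * score f r (p.1 + p.2))
        ∂((jointLaw f r).map (fun p => (p.1, p.2 - ε))) := by
    rw [integral_map hm.aemeasurable (Measurable.aestronglyMeasurable (by fun_prop))]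
    simp only [add_sub_assoc]
  rw [e1, map_shift_jointLaw hr,
    integral_withDensity_eq_integral_toReal_smul (by fun_prop) (by simp)]
  simp only [ENNReal.toReal_ofReal (Real.exp_nonneg _), smul_eq_mul]
  have e2 : ∀ p : ℝ × ℝ, -(ε / r * (r * score f r (p.1 + p.2))) = -ε * score f r (p.1 + p.2) :=
    fun p => by field_simp
  simp_rw [e2] at h
  refine h.trans_eq ?_
  rw [Real.sqrt_mul (sq_nonneg r), Real.sqrt_sq hr.le, abs_div, abs_of_pos hr, scoreConst]
  field_simp

end

end LocationMLE

/-! ### Lower bound on the Fisher information -/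

namespace LocationMLE

noncomputable section

variable {f : Measure ℝ} {r : ℝ} [IsProbabilityMeasure f]

/-- From `u⁴ ≤ 24 exp |u|` and `E exp |u| ≤ 2 √e ≤ 4`; the crude value 96 is what calls for the
constant 14 below. -/
lemma integral_noise_pow_four_le (hr : 0 < r) :
    ∫ z, z ^ 4 ∂(gaussianReal 0 (r ^ 2).toNNReal) ≤ 96 * r ^ 4 := by
  have hU := hasSubgaussianMGF_noise (f := gaussianReal 0 1) hr
  have h1 := integral_exp_mul_abs_le hU 1
  have hexp : Real.exp (1 ^ 2 / 2) ≤ 2 := by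
    have : Real.exp (1 ^ 2 / 2) ^ 2 = Real.exp 1 := by
      rw [← Real.exp_nat_mul]; norm_num
    nlinarith [Real.exp_one_lt_d9, Real.exp_pos (1 ^ 2 / 2)]
  have iU := integrable_exp_mul_abs (hU.integrable_exp_mul 1) (hU.integrable_exp_mul (-1))
  have h2 : ∫ p, p.2 ^ 4 ∂(jointLaw (gaussianReal 0 1) r) ≤
      ∫ p, 24 * r ^ 4 * Real.exp (1 * |-p.2 / r|) ∂(jointLaw (gaussianReal 0 1) r) := by
    refine integral_mono_of_nonneg (ae_of_all _ fun p => by positivity) (iU.const_mul _)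
      (ae_of_all _ fun p => ?_)
    have h := Real.pow_div_factorial_le_exp |-p.2 / r| (abs_nonneg _) 4
    rw [div_le_iff₀ (by positivity)] at h
    have e : p.2 ^ 4 = r ^ 4 * |-p.2 / r| ^ 4 := by
      rw [abs_div, abs_neg, abs_of_pos hr, div_pow, Even.pow_abs (by decide)]
      field_simp
    simp only [one_mul]
    rw [e]
    simp only [Nat.factorial] at h
    push_cast at h
    nlinarith [pow_pos hr 4]
  rw [integral_const_mul, jointLaw, integral_fun_snd (fun z : ℝ => z ^ 4)] at h2
  simp only [probReal_univ, one_smul] at h2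
  refine h2.trans ?_
  have := pow_pos hr 4
  change 24 * r ^ 4 * (∫ p, Real.exp (1 * |-p.2 / r|) ∂(jointLaw (gaussianReal 0 1) r)) ≤ _
  nlinarith

lemma integral_noise_sq : ∫ z, z ^ 2 ∂(gaussianReal 0 (r ^ 2).toNNReal) = r ^ 2 := by
  have h := variance_fun_id_gaussianReal (μ := 0) (v := (r ^ 2).toNNReal)
  rw [variance_of_integral_eq_zero (by fun_prop) (by simp), coe_toNNReal_sq] at h
  exact h

lemma quantile_le_quantile {p q a b : ℝ} (ha : IsQuantile f p a) (hb : IsQuantile f q b)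
    (hpq : p < q) : a ≤ b := by
  by_contra! h
  have : f.real (Set.Iic b) ≤ f.real (Set.Iio a) :=
    measureReal_mono fun x hx => lt_of_le_of_lt hx h
  linarith [ha.1, hb.2]

lemma sub_le_measureReal_Icc {p q a b : ℝ} (ha : IsQuantile f p a) (hb : IsQuantile f q b) :
    q - p ≤ f.real (Set.Icc a b) := by
  have h : f.real (Set.Iic b) ≤ f.real (Set.Iio a) + f.real (Set.Icc a b) := by
    refine le_trans ?_ (measureReal_union_le _ _)
    refine measureReal_mono fun x hx => ?_
    rcases lt_or_ge x a with h | h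
    · exact Or.inl h
    · exact Or.inr ⟨h, hx⟩
  linarith [ha.1, hb.2]

/-- The Fisher information of the smoothed distribution is bounded below in terms of the width of
an interval that carries half of the mass. -/
lemma one_le_sqrt_fisherInfo (hr : 0 < r) {q₁ q₃ : ℝ} (hq : q₁ ≤ q₃)
    (hmass : 1 / 2 ≤ f.real (Set.Icc q₁ q₃)) :
    1 ≤ 4 * (q₃ - q₁ + 14 * r) * √(fisherInfo f r) := by
  set T := q₃ - q₁ + 14 * r with hT
  have hT0 : 0 < T := by rw [hT]; nlinarith
  -- A bounded test function, linear of slope `1 / T` near `q₁`. By Cauchy–Schwarz its correlation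
  -- with the score is at most `√I`, and by projection this correlation equals one with the noise.
  -- The margin `14 r` in `T` keeps `y + z` in the linear range for `y` in `[q₁, q₃]` and `|z| ≤ 14
  -- r`.
  set g : ℝ → ℝ := fun x => max (-1) (min 1 ((x - q₁) / T)) with hg
  have hgm : Measurable g := by fun_prop
  have hgmono : Monotone g := fun x y hxy => by
    simp only [hg]
    gcongr
  have hg1 : ∀ x, |g x| ≤ 1 := fun x => by
    rw [abs_le]
    exact ⟨le_max_left _ _, max_le (by norm_num) (min_le_left _ _)⟩
  have hgeq : ∀ x, |x - q₁| ≤ T → g x = (x - q₁) / T := fun x hx => by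
    rw [abs_le] at hx
    simp only [hg]
    rw [min_eq_right, max_eq_right]
    · rw [le_div_iff₀ hT0]; linarith
    · rw [div_le_iff₀ hT0]; linarith
  have hs := measurable_score (f := f) hr
  have hsL := memLp_score (f := f) hr 2
  have hs1 : Integrable (fun p : ℝ × ℝ => score f r (p.1 + p.2)) (jointLaw f r) :=
    hsL.integrable (by simp)
  have hz1 : Integrable (fun p : ℝ × ℝ => -p.2 / r ^ 2) (jointLaw f r) :=
    (memLp_noise hr 2).integrable (by simp)
  have i1 : Integrable (fun p : ℝ × ℝ => -p.2 / r ^ 2 * g (p.1 + p.2)) (jointLaw f r) :=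
    hz1.mul_bdd (c := 1) (Measurable.aestronglyMeasurable (by fun_prop)) (ae_of_all _ fun p => hg1 _)
  have i2 : Integrable (fun p : ℝ × ℝ => score f r (p.1 + p.2) * g (p.1 + p.2)) (jointLaw f r) :=
    hs1.mul_bdd (c := 1) (Measurable.aestronglyMeasurable (by fun_prop)) (ae_of_all _ fun p => hg1 _)
  have i3 : Integrable (fun p : ℝ × ℝ => -p.2 / r ^ 2 * g p.1) (jointLaw f r) :=
    hz1.mul_bdd (c := 1) (Measurable.aestronglyMeasurable (by fun_prop)) (ae_of_all _ fun p => hg1 _)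
  have hproj := integral_noise_mul (f := f) hr hgm i1 i2
  have hup : -∫ p, score f r (p.1 + p.2) * g (p.1 + p.2) ∂(jointLaw f r) ≤ √(fisherInfo f r) := by
    have h1 := integral_mul_le_sqrt_mul_sqrt (μ := jointLaw f r)
      (X := fun p => |score f r (p.1 + p.2)|) (Y := fun _ => 1) (fun _ => abs_nonneg _)
      (fun _ => zero_le_one) hsL.norm (memLp_const 1)
    simp only [sq_abs, ← fisherInfo_eq hr, mul_one, one_pow, integral_const, probReal_univ,
      smul_eq_mul, Real.sqrt_one] at h1
    refine le_trans ?_ h1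
    rw [← integral_neg]
    refine integral_mono i2.neg hs1.abs fun p => ?_
    calc -(score f r (p.1 + p.2) * g (p.1 + p.2))
        ≤ |score f r (p.1 + p.2) * g (p.1 + p.2)| := neg_le_abs _
      _ = |score f r (p.1 + p.2)| * |g (p.1 + p.2)| := abs_mul _ _
      _ ≤ |score f r (p.1 + p.2)| * 1 := by gcongr; exact hg1 _
      _ = _ := mul_one _
  -- Signal and noise are independent and the noise is centred, so `g p.1` can be subtracted for
  -- free; by monotonicity of `g` the resulting integrand has a constant sign.
  have hzero : ∫ p, -p.2 / r ^ 2 * g p.1 ∂(jointLaw f r) = 0 := by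
    have := integral_prod_mul (μ := f) (ν := gaussianReal 0 (r ^ 2).toNNReal)
      g (fun z : ℝ => -z / r ^ 2)
    rw [jointLaw]
    simp_rw [mul_comm (-_ / r ^ 2)]
    rw [this, integral_div, integral_neg]
    simp
  set A := Set.Icc q₁ q₃
  -- The polynomial `z² - z⁴ / (14 r)²` stands in for `z²` truncated at `|z| ≤ 14 r`: it is below
  -- `z²` and nonpositive outside, so full moments suffice. Its mean is at least `r² / 2` because
  -- `96 / 196 ≤ 1 / 2`.
  have hlow : ∀ p : ℝ × ℝ, A.indicator 1 p.1 * ((p.2 ^ 2 - p.2 ^ 4 / (196 * r ^ 2)) / (r ^ 2 * T)) ≤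
      -(-p.2 / r ^ 2 * g (p.1 + p.2) - -p.2 / r ^ 2 * g p.1) := fun p => by
    obtain ⟨y, z⟩ := p
    have hrhs : -(-z / r ^ 2 * g (y + z) - -z / r ^ 2 * g y) = z * (g (y + z) - g y) / r ^ 2 := by
      ring
    have hnn : 0 ≤ z * (g (y + z) - g y) := by
      rcases le_total 0 z with h | h
      · exact mul_nonneg h (sub_nonneg.2 (hgmono (by linarith)))
      · exact mul_nonneg_of_nonpos_of_nonpos h (sub_nonpos.2 (hgmono (by linarith)))
    simp only
    rw [hrhs]
    by_cases hy : y ∈ A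
    · rw [Set.indicator_of_mem hy, Pi.one_apply, one_mul]
      by_cases hz : |z| ≤ 14 * r
      · have h1 : |y - q₁| ≤ T := by
          rw [abs_of_nonneg (sub_nonneg.2 hy.1)]
          have := hy.2
          rw [hT]; linarith
        have h2 : |y + z - q₁| ≤ T := by
          have h3 : |y - q₁| ≤ q₃ - q₁ := by
            rw [abs_of_nonneg (sub_nonneg.2 hy.1)]
            have := hy.2
            linarith
          calc |y + z - q₁| = |(y - q₁) + z| := by ring_nf
            _ ≤ |y - q₁| + |z| := abs_add_le _ _
            _ ≤ T := by rw [hT]; linarith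
        rw [hgeq _ h1, hgeq _ h2]
        have h3 : z * ((y + z - q₁) / T - (y - q₁) / T) / r ^ 2 = z ^ 2 / (r ^ 2 * T) := by
          field_simp
          ring
        rw [h3]
        gcongr
        have : 0 ≤ z ^ 4 / (196 * r ^ 2) := by positivity
        linarith
      · push Not at hz
        refine le_trans ?_ (div_nonneg hnn (sq_nonneg r))
        refine div_nonpos_of_nonpos_of_nonneg ?_ (by positivity)
        rw [sub_nonpos, le_div_iff₀ (by positivity)]
        have h4 : 196 * r ^ 2 ≤ z ^ 2 := by
          rw [← sq_abs z]
          nlinarith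
        nlinarith [sq_nonneg z]
    · rw [Set.indicator_of_notMem hy, zero_mul]
      exact div_nonneg hnn (sq_nonneg r)
  have iz2 : Integrable (fun z : ℝ => z ^ 2) (gaussianReal 0 (r ^ 2).toNNReal) :=
    (memLp_id_gaussianReal 2).integrable_sq
  have iz4 : Integrable (fun z : ℝ => z ^ 4) (gaussianReal 0 (r ^ 2).toNNReal) := by
    have := (memLp_id_gaussianReal (μ := 0) (v := (r ^ 2).toNNReal) 4).integrable_norm_pow (by simp)
    refine this.congr (ae_of_all _ fun z => ?_)
    simp only [id, Real.norm_eq_abs]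
    exact Even.pow_abs (by decide) z
  have iz : Integrable (fun z : ℝ => (z ^ 2 - z ^ 4 / (196 * r ^ 2)) / (r ^ 2 * T))
      (gaussianReal 0 (r ^ 2).toNNReal) := (iz2.sub (iz4.div_const _)).div_const _
  have iA : Integrable (A.indicator (1 : ℝ → ℝ)) f :=
    (integrable_const (1 : ℝ)).indicator measurableSet_Icc
  have hint : 1 / (4 * T) ≤
      ∫ p : ℝ × ℝ, A.indicator 1 p.1 * ((p.2 ^ 2 - p.2 ^ 4 / (196 * r ^ 2)) / (r ^ 2 * T))
        ∂(jointLaw f r) := by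
    rw [jointLaw, integral_prod_mul (A.indicator (1 : ℝ → ℝ))
      (fun z : ℝ => (z ^ 2 - z ^ 4 / (196 * r ^ 2)) / (r ^ 2 * T)), integral_indicator_one measurableSet_Icc,
      integral_div, integral_sub iz2 (iz4.div_const _), integral_div, integral_noise_sq]
    have h4 := integral_noise_pow_four_le hr
    have h5 : (1 : ℝ) / (2 * T) ≤
        (r ^ 2 - (∫ z, z ^ 4 ∂(gaussianReal 0 (r ^ 2).toNNReal)) / (196 * r ^ 2)) / (r ^ 2 * T) := by
      rw [div_le_div_iff₀ (by positivity) (by positivity)]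
      have h6 : (∫ z, z ^ 4 ∂(gaussianReal 0 (r ^ 2).toNNReal)) / (196 * r ^ 2) ≤ r ^ 2 / 2 := by
        rw [div_le_iff₀ (by positivity)]
        nlinarith [pow_pos hr 4]
      nlinarith
    calc 1 / (4 * T) = 1 / 2 * (1 / (2 * T)) := by field_simp; norm_num
      _ ≤ _ := by gcongr
  have hfin : 1 / (4 * T) ≤ √(fisherInfo f r) := by
    refine hint.trans (le_trans ?_ hup)
    rw [← hproj]
    refine (integral_mono (iA.mul_prod iz) (i1.sub i3).neg hlow).trans_eq ?_
    refine (integral_neg _).trans ?_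
    refine congrArg Neg.neg ((integral_sub' i1 i3).trans ?_)
    rw [hzero, sub_zero]
  rw [div_le_iff₀ (by positivity)] at hfin
  linarith

end

end LocationMLE

/-! ### Existence and length of the shortest quantile window -/

namespace LocationMLE

noncomputable section

open Filter Topology

variable {f : Measure ℝ} [IsProbabilityMeasure f]

lemma exists_lt_measureReal_Icc {c : ℝ} (hc : c < 1) :
    ∃ R : ℝ, 0 < R ∧ c < f.real (Set.Icc (-R) R) := by
  have hmono : Monotone fun n : ℕ => Set.Icc (-(n : ℝ)) n := fun m n hmn => by
    have : (m : ℝ) ≤ n := by exact_mod_cast hmn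
    exact Set.Icc_subset_Icc (by linarith) this
  have h := tendsto_measure_iUnion_atTop (μ := f) hmono
  have hU : ⋃ n : ℕ, Set.Icc (-(n : ℝ)) n = Set.univ := by
    refine Set.eq_univ_of_forall fun x => ?_
    obtain ⟨n, hn⟩ := exists_nat_ge |x|
    exact Set.mem_iUnion.2 ⟨n, abs_le.1 hn⟩
  rw [hU, measure_univ] at h
  have h' : Tendsto (fun n : ℕ => f.real (Set.Icc (-(n : ℝ)) n)) atTop (𝓝 1) := by
    have := (ENNReal.tendsto_toReal ENNReal.one_ne_top).comp h
    rw [ENNReal.toReal_one] at this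
    exact this
  obtain ⟨n, hn, hn0⟩ := ((h'.eventually (lt_mem_nhds hc)).and (eventually_gt_atTop 0)).exists
  exact ⟨n, by exact_mod_cast hn0, hn⟩

/-- The mass of a closed interval is upper semicontinuous in its endpoints, since the interval is a
decreasing intersection of larger ones. -/
lemma isClosed_setOf_le_measureReal_Icc (m : ℝ) :
    IsClosed {p : ℝ × ℝ | m ≤ f.real (Set.Icc p.1 p.2)} := by
  rw [← isOpen_compl_iff, isOpen_iff_mem_nhds]
  rintro ⟨a, b⟩ hab
  simp only [Set.mem_compl_iff, Set.mem_ofPred_eq, not_le] at hab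
  set s : ℕ → Set ℝ := fun n => Set.Icc (a - 1 / ((n : ℝ) + 1)) (b + 1 / ((n : ℝ) + 1)) with hs
  have hanti : Antitone s := fun i j hij => by
    have : 1 / ((j : ℝ) + 1) ≤ 1 / ((i : ℝ) + 1) := one_div_le_one_div_of_le (by positivity)
      (by have : (i : ℝ) ≤ j := by exact_mod_cast hij
          linarith)
    exact Set.Icc_subset_Icc (by linarith) (by linarith)
  have hinter : ⋂ n, s n = Set.Icc a b := by
    refine Set.Subset.antisymm (fun x hx => ?_) (Set.subset_iInter fun n => ?_)
    · have hx' : ∀ n, x ∈ s n := Set.mem_iInter.1 hx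
      have ht := tendsto_one_div_add_atTop_nhds_zero_nat (𝕜 := ℝ)
      constructor
      · have h1 : Tendsto (fun n : ℕ => a - 1 / ((n : ℝ) + 1)) atTop (𝓝 a) := by
          simpa using ht.const_sub a
        exact le_of_tendsto' h1 fun n => (hx' n).1
      · have h1 : Tendsto (fun n : ℕ => b + 1 / ((n : ℝ) + 1)) atTop (𝓝 b) := by
          simpa using ht.const_add b
        exact ge_of_tendsto' h1 fun n => (hx' n).2
    · have : 0 < 1 / ((n : ℝ) + 1) := by positivity
      exact Set.Icc_subset_Icc (by linarith) (by linarith)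
  have h := tendsto_measure_iInter_atTop (μ := f) (s := s)
    (fun n => measurableSet_Icc.nullMeasurableSet) hanti ⟨0, measure_ne_top _ _⟩
  rw [hinter] at h
  have h' : Tendsto (fun n => f.real (s n)) atTop (𝓝 (f.real (Set.Icc a b))) :=
    (ENNReal.tendsto_toReal (measure_ne_top _ _)).comp h
  obtain ⟨n, hn⟩ := (h'.eventually (gt_mem_nhds hab)).exists
  have hpos : 0 < 1 / ((n : ℝ) + 1) := by positivity
  refine Filter.mem_of_superset (prod_mem_nhds (Ioi_mem_nhds (sub_lt_self a hpos))
    (Iio_mem_nhds (lt_add_of_pos_right b hpos))) ?_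
  rintro ⟨a', b'⟩ ⟨ha', hb'⟩
  simp only [Set.mem_compl_iff, Set.mem_ofPred_eq, not_le]
  exact lt_of_le_of_lt (measureReal_mono (Set.Icc_subset_Icc (le_of_lt ha') (le_of_lt hb'))) hn

/-- Among the closed intervals of mass at least `m` there is a shortest one. -/
lemma exists_shortest_Icc {m : ℝ} (hm0 : 0 < m) (hm1 : m < 1) :
    ∃ a b : ℝ, m ≤ f.real (Set.Icc a b) ∧
      ∀ a' b', m ≤ f.real (Set.Icc a' b') → b - a ≤ b' - a' := by
  -- Mass above `m` makes `[-R, R]` a competitor of length `2 R`; mass above `1 - m` makes every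
  -- competitor meet it. Those shorter than `2 R` therefore lie in `[-3R, 3R]`, and compactness
  -- applies.
  obtain ⟨R, hR0, hR⟩ := exists_lt_measureReal_Icc (f := f) (max_lt hm1 (by linarith : 1 - m < 1))
  obtain ⟨hR1, hR2⟩ := max_lt_iff.1 hR
  set K := (Set.Icc (-3 * R) (3 * R) ×ˢ Set.Icc (-3 * R) (3 * R)) ∩
    {p : ℝ × ℝ | m ≤ f.real (Set.Icc p.1 p.2)} with hK
  have hKc : IsCompact K :=
    (isCompact_Icc.prod isCompact_Icc).inter_right (isClosed_setOf_le_measureReal_Icc m)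
  have hKR : ((-R, R) : ℝ × ℝ) ∈ K :=
    ⟨⟨⟨by simp only; linarith, by simp only; linarith⟩,
      ⟨by simp only; linarith, by simp only; linarith⟩⟩, hR1.le⟩
  obtain ⟨⟨a, b⟩, hab, hmin⟩ := hKc.exists_isMinOn ⟨_, hKR⟩
    (f := fun p : ℝ × ℝ => p.2 - p.1) (by fun_prop)
  refine ⟨a, b, hab.2, fun a' b' h' => ?_⟩
  by_cases hlen : 2 * R ≤ b' - a'
  · have := hmin hKR
    simp only [Set.mem_ofPred_eq] at this
    linarith
  · push Not at hlen
    have hmeet : (Set.Icc a' b' ∩ Set.Icc (-R) R).Nonempty := by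
      by_contra hne
      rw [Set.not_nonempty_iff_eq_empty, ← Set.disjoint_iff_inter_eq_empty] at hne
      have := measureReal_union (μ := f) hne measurableSet_Icc
      linarith [measureReal_le_one (μ := f) (s := Set.Icc a' b' ∪ Set.Icc (-R) R)]
    obtain ⟨x, hx1, hx2⟩ := hmeet
    obtain ⟨h1, h2⟩ := hx1
    obtain ⟨h3, h4⟩ := hx2
    have hmem : ((a', b') : ℝ × ℝ) ∈ K :=
      ⟨⟨⟨by simp only; linarith, by simp only; linarith⟩,
        ⟨by simp only; linarith, by simp only; linarith⟩⟩, h'⟩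
    exact hmin hmem

lemma measureReal_Ioo_le_of_forall_Icc {a b m : ℝ}
    (h : ∀ a' b', a < a' → b' < b → f.real (Set.Icc a' b') ≤ m) : f.real (Set.Ioo a b) ≤ m := by
  set s : ℕ → Set ℝ := fun n => Set.Icc (a + 1 / ((n : ℝ) + 1)) (b - 1 / ((n : ℝ) + 1)) with hs
  have hmono : Monotone s := fun i j hij => by
    have : 1 / ((j : ℝ) + 1) ≤ 1 / ((i : ℝ) + 1) := one_div_le_one_div_of_le (by positivity)
      (by have : (i : ℝ) ≤ j := by exact_mod_cast hij
          linarith)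
    exact Set.Icc_subset_Icc (by linarith) (by linarith)
  have hsub : Set.Ioo a b ⊆ ⋃ n, s n := fun x hx => by
    obtain ⟨n, hn⟩ := exists_nat_one_div_lt (lt_min (sub_pos.2 hx.1) (sub_pos.2 hx.2))
    obtain ⟨h1, h2⟩ := lt_min_iff.1 hn
    exact Set.mem_iUnion.2 ⟨n, by linarith, by linarith⟩
  have ht := tendsto_measure_iUnion_atTop (μ := f) hmono
  have ht' : Tendsto (fun n => f.real (s n)) atTop (𝓝 (f.real (⋃ n, s n))) :=
    (ENNReal.tendsto_toReal (measure_ne_top _ _)).comp ht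
  refine (measureReal_mono hsub).trans (le_of_tendsto' ht' fun n => h _ _ ?_ ?_)
  · have : 0 < 1 / ((n : ℝ) + 1) := by positivity
    linarith
  · have : 0 < 1 / ((n : ℝ) + 1) := by positivity
    linarith

/-- Shortest windows exist, and they are no longer than any interval of mass `2 t`. -/
lemma exists_isShortestWindow {t : ℝ} (ht0 : 0 < t) (ht1 : 2 * t < 1) :
    ∃ α a b : ℝ, IsShortestWindow f t α a b ∧
      ∀ a' b', 2 * t ≤ f.real (Set.Icc a' b') → b - a ≤ b' - a' := by
  obtain ⟨a, b, hab, hmin⟩ := exists_shortest_Icc (f := f) (by linarith : 0 < 2 * t) ht1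
  have hle : a ≤ b := by
    by_contra! h
    rw [Set.Icc_eq_empty (not_le.2 h), measureReal_empty] at hab
    linarith
  have hIa : f.real (Set.Iio a) ≤ f.real (Set.Iic a) := measureReal_mono Set.Iio_subset_Iic_self
  have hIb : f.real (Set.Iio b) ≤ f.real (Set.Iic b) := measureReal_mono Set.Iio_subset_Iic_self
  have h1 : f.real (Set.Iio a) ≤ f.real (Set.Iic b) - 2 * t := by
    have hd : Disjoint (Set.Iio a) (Set.Icc a b) :=
      Set.disjoint_left.2 fun x hx hx' => absurd hx'.1 (not_le.2 hx)
    have h2 := measureReal_union (μ := f) hd measurableSet_Icc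
    have h3 : f.real (Set.Iio a ∪ Set.Icc a b) ≤ f.real (Set.Iic b) :=
      measureReal_mono (Set.union_subset (fun x hx => (le_of_lt hx).trans hle) fun x hx => hx.2)
    linarith
  have h2 : f.real (Set.Iio b) - 2 * t ≤ f.real (Set.Iic a) := by
    -- A closed interval strictly inside with mass above `2 t` would be a shorter competitor.
    have h3 : f.real (Set.Ioo a b) ≤ 2 * t := by
      refine measureReal_Ioo_le_of_forall_Icc fun a' b' ha' hb' => ?_
      by_contra! h
      have := hmin a' b' h.le
      linarith
    have h4 : f.real (Set.Iio b) ≤ f.real (Set.Iic a) + f.real (Set.Ioo a b) := by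
      refine le_trans (measureReal_mono fun x hx => ?_) (measureReal_union_le _ _)
      rcases le_or_gt x a with h | h
      · exact Or.inl h
      · exact Or.inr ⟨h, hx⟩
    linarith
  -- `a` must be a `p`-quantile and `b` a `(p + 2 t)`-quantile: two lower and two upper bounds on
  -- `p`, all compatible by `hIa`, `hIb`, `h1`, `h2`. The least admissible `p` is taken. The choice
  -- matters only if `f` has atoms or gaps.
  set p := max (f.real (Set.Iio a)) (f.real (Set.Iio b) - 2 * t) with hp
  have hp1 : f.real (Set.Iio a) ≤ p := le_max_left _ _
  have hp2 : f.real (Set.Iio b) - 2 * t ≤ p := le_max_right _ _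
  have hp3 : p ≤ f.real (Set.Iic a) := max_le hIa h2
  have hp4 : p ≤ f.real (Set.Iic b) - 2 * t := max_le h1 (by linarith)
  refine ⟨p + t, a, b, ⟨⟨?_, ?_⟩, ⟨?_, ?_⟩, ⟨?_, ?_⟩, fun α' a' b' hα' ha' hb' => ?_⟩, hmin⟩
  · linarith [measureReal_nonneg (μ := f) (s := Set.Iio a)]
  · linarith [measureReal_le_one (μ := f) (s := Set.Iic b)]
  · linarith
  · linarith
  · linarith
  · linarith
  · refine hmin a' b' ?_
    linarith [sub_le_measureReal_Icc ha' hb']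

lemma measureReal_Icc_le_sum (q h : ℝ) (k : ℕ) :
    f.real (Set.Icc q (q + (k + 1) * h)) ≤
      ∑ i ∈ Finset.range (k + 1), f.real (Set.Icc (q + i * h) (q + (i + 1) * h)) := by
  induction k with
  | zero => simp
  | succ k ih =>
    rw [Finset.sum_range_succ]
    refine le_trans ?_ (add_le_add_left ih _)
    refine le_trans (measureReal_mono fun x hx => ?_) (measureReal_union_le _ _)
    push_cast at hx ⊢
    rcases le_total x (q + (k + 1) * h) with h' | h'
    · exact Or.inl ⟨hx.1, h'⟩
    · exact Or.inr ⟨h', hx.2⟩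

/-- Pigeonhole over `k + 1` equal pieces. -/
lemma exists_Icc_mass_ge {q₁ q₃ : ℝ} (hmass : 1 / 2 ≤ f.real (Set.Icc q₁ q₃)) (k : ℕ) :
    ∃ a b : ℝ, b - a = (q₃ - q₁) / (k + 1) ∧ 1 / (2 * (k + 1)) ≤ f.real (Set.Icc a b) := by
  have hk : (0 : ℝ) < k + 1 := by positivity
  set h := (q₃ - q₁) / (k + 1) with hh
  have h1 : q₁ + (k + 1) * h = q₃ := by rw [hh]; field_simp; ring
  have hsum := measureReal_Icc_le_sum (f := f) q₁ h k
  rw [h1] at hsum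
  have h2 : ∑ i ∈ Finset.range (k + 1), 1 / (2 * ((k : ℝ) + 1)) ≤
      ∑ i ∈ Finset.range (k + 1), f.real (Set.Icc (q₁ + i * h) (q₁ + (i + 1) * h)) := by
    refine le_trans (le_of_eq ?_) (hmass.trans hsum)
    rw [Finset.sum_const, Finset.card_range, nsmul_eq_mul]
    push_cast
    field_simp
  obtain ⟨i, -, hi⟩ := Finset.exists_le_of_sum_le (by simp) h2
  exact ⟨q₁ + i * h, q₁ + (i + 1) * h, by ring, hi⟩

lemma IsShortestWindow.length_le {t α a b q₁ q₃ : ℝ} (hw : IsShortestWindow f t α a b)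
    (ht0 : 0 < t) (ht1 : 4 * t ≤ 1) (hq : q₁ ≤ q₃) (hmass : 1 / 2 ≤ f.real (Set.Icc q₁ q₃)) :
    b - a ≤ 8 * t * (q₃ - q₁) := by
  obtain ⟨α', c, d, hcd, hmin⟩ := exists_isShortestWindow (f := f) ht0 (by linarith)
  have h1 : 1 ≤ 1 / (4 * t) := by rw [le_div_iff₀ (by positivity)]; linarith
  -- The number of pieces `⌊1 / (4t)⌋ = k + 1` lies between `1 / (8t)` and `1 / (4t)`: the upper
  -- bound gives the heaviest piece mass at least `2 t`, the lower one makes it short.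
  have hk1 : 1 ≤ ⌊1 / (4 * t)⌋₊ := Nat.one_le_floor_iff _ |>.2 h1
  obtain ⟨k, hk⟩ := Nat.exists_eq_add_of_le' hk1
  have hle : (k : ℝ) + 1 ≤ 1 / (4 * t) := by
    have := Nat.floor_le (zero_le_one.trans h1)
    rw [hk] at this
    exact_mod_cast this
  have hge : 1 / (8 * t) ≤ (k : ℝ) + 1 := by
    have h2 := Nat.lt_floor_add_one (1 / (4 * t))
    rw [hk] at h2
    push_cast at h2
    have h3 : 1 / (8 * t) = 1 / (4 * t) / 2 := by field_simp; norm_num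
    have h4 : (0 : ℝ) ≤ k := by positivity
    linarith
  obtain ⟨x, y, hxy, hm⟩ := exists_Icc_mass_ge hmass k
  have h2 : 2 * t ≤ 1 / (2 * ((k : ℝ) + 1)) := by
    rw [le_div_iff₀ (by positivity)] at hle ⊢
    linarith
  -- `shortest` only compares quantile windows; the window `(c, d)` is the bridge to arbitrary
  -- intervals of mass `2 t`.
  have h3 := hmin x y (h2.trans hm)
  have h4 := hw.shortest α' c d hcd.mem hcd.left hcd.right
  have h5 : (q₃ - q₁) / (k + 1) ≤ 8 * t * (q₃ - q₁) := by
    rw [div_le_iff₀ (by positivity)]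
    rw [div_le_iff₀ (by positivity)] at hge
    nlinarith [sub_nonneg.2 hq]
  linarith

end

end LocationMLE

/-! ### Outputs of the algorithm, and Hoeffding's bound for the initial interval -/

namespace LocationMLE

noncomputable section

/-- The smallest sample value whose empirical distribution function reaches `p` works: otherwise the
largest sample strictly below it would reach `p` too. -/
lemma exists_isSampleQuantile {n : ℕ} (hn : 0 < n) (x : Fin n → ℝ) {p : ℝ} (hp0 : 0 ≤ p)
    (hp1 : p ≤ 1) : ∃ z, IsSampleQuantile x p z := by
  have : Nonempty (Fin n) := ⟨⟨0, hn⟩⟩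
  set S : Finset (Fin n) := Finset.univ.filter fun i =>
    p * n ≤ ((Finset.univ.filter fun j => x j ≤ x i).card : ℝ) with hS
  have hSne : S.Nonempty := by
    obtain ⟨i, hi⟩ := Finite.exists_max x
    refine ⟨i, ?_⟩
    simp only [hS, Finset.mem_filter, Finset.mem_univ, true_and]
    rw [Finset.filter_true_of_mem (fun j _ => hi j), Finset.card_univ, Fintype.card_fin]
    exact mul_le_of_le_one_left (by positivity) hp1
  obtain ⟨i, hiS, himin⟩ := Finset.exists_min_image S x hSne
  refine ⟨x i, ?_, (Finset.mem_filter.1 hiS).2⟩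
  by_contra! h
  have hne : (Finset.univ.filter fun j => x j < x i).Nonempty := by
    rw [← Finset.card_pos]
    have : (0 : ℝ) < ((Finset.univ.filter fun j => x j < x i).card : ℝ) :=
      lt_of_le_of_lt (by positivity) h
    exact_mod_cast this
  obtain ⟨k, hk, hkmax⟩ := Finset.exists_max_image _ x hne
  have hki : x k < x i := (Finset.mem_filter.1 hk).2
  have hkS : k ∈ S := by
    simp only [hS, Finset.mem_filter, Finset.mem_univ, true_and]
    refine h.le.trans ?_
    exact_mod_cast Finset.card_le_card fun j hj => by
      simp only [Finset.mem_filter, Finset.mem_univ, true_and]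
      exact hkmax j hj
  exact absurd (himin k hkS) (not_le.2 hki)

section output

variable {f : Measure ℝ} {r : ℝ} {n : ℕ}

/-- If the empirical score has the right sign at distance at least `ε₀` from `lam`, every output of
the local procedure is within `ε₀` of `lam`. -/
lemma IsLocalMLEOutput.abs_sub_le {x' : Fin n → ℝ} {l u θ lam ε₀ : ℝ}
    (h : IsLocalMLEOutput f r x' l u θ) (hlam : lam ∈ Set.Icc l u) (hε₀ : 0 ≤ ε₀)
    (hpos : ∀ ε, ε₀ ≤ ε → ε ≤ u - l → 0 < empiricalScore f r x' (lam + ε))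
    (hneg : ∀ ε, ε₀ ≤ ε → ε ≤ u - l → empiricalScore f r x' (lam - ε) < 0) :
    |θ - lam| ≤ ε₀ := by
  obtain ⟨hθ, hcase⟩ := h
  obtain ⟨hl, hu⟩ := hlam
  obtain ⟨hθl, hθu⟩ := hθ
  have key1 : ε₀ < θ - lam → 0 < empiricalScore f r x' θ := fun h => by
    have := hpos (θ - lam) h.le (by linarith)
    rwa [add_sub_cancel] at this
  have key2 : ε₀ < lam - θ → empiricalScore f r x' θ < 0 := fun h => by
    have := hneg (lam - θ) h.le (by linarith)
    rwa [sub_sub_cancel] at this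
  rw [abs_le]
  rcases hcase with h0 | ⟨hall, rfl⟩ | ⟨hall, rfl⟩
  · constructor
    · by_contra! hc
      exact absurd h0 (key2 (by linarith)).ne
    · by_contra! hc
      exact absurd h0 (key1 hc).ne'
  · refine ⟨by linarith, ?_⟩
    by_contra! hc
    exact absurd (hall _ ⟨hθl, le_rfl⟩) (not_lt.2 (key1 hc).le)
  · refine ⟨?_, by linarith⟩
    by_contra! hc
    exact absurd (hall _ ⟨le_rfl, hθu⟩) (not_lt.2 (key2 (by linarith)).le)

variable [IsProbabilityMeasure f]

lemma continuous_empiricalScore (hr : 0 < r) (x' : Fin n → ℝ) :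
    Continuous (empiricalScore f r x') := by
  have := continuous_score (f := f) hr
  unfold empiricalScore
  fun_prop

/-- A continuous empirical score without a root keeps its sign, by the intermediate value theorem.
-/
lemma exists_isLocalMLEOutput (hr : 0 < r) (x' : Fin n → ℝ) {l u : ℝ} (hlu : l ≤ u) :
    ∃ θ, IsLocalMLEOutput f r x' l u θ := by
  have hc := (continuous_empiricalScore (f := f) hr x').continuousOn (s := Set.Icc l u)
  by_cases hroot : ∃ θ ∈ Set.Icc l u, empiricalScore f r x' θ = 0
  · obtain ⟨θ, hθ, h0⟩ := hroot
    exact ⟨θ, hθ, Or.inl h0⟩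
  push Not at hroot
  by_cases hneg : ∀ τ ∈ Set.Icc l u, empiricalScore f r x' τ < 0
  · exact ⟨u, Set.right_mem_Icc.2 hlu, Or.inr (Or.inl ⟨hneg, rfl⟩)⟩
  · push Not at hneg
    obtain ⟨σ, hσ, hσ0⟩ := hneg
    refine ⟨l, Set.left_mem_Icc.2 hlu, Or.inr (Or.inr ⟨fun τ hτ => ?_, rfl⟩)⟩
    by_contra! hτ0
    obtain ⟨θ, hθ, h0⟩ := isPreconnected_Icc.intermediate_value hτ hσ hc ⟨hτ0, hσ0⟩
    exact hroot θ hθ h0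

lemma exists_isGlobalMLEOutput (hr : 0 < r) (hn : 0 < n) {α a b t : ℝ} (ht : 0 < t)
    (hw : IsShortestWindow f t α a b) (x z : Fin n → ℝ) :
    ∃ θ, IsGlobalMLEOutput f r α a b x z θ := by
  obtain ⟨q, hq⟩ := exists_isSampleQuantile hn x (ht.le.trans hw.mem.1)
    (hw.mem.2.trans (by linarith))
  have hab := quantile_le_quantile hw.left hw.right (by linarith)
  obtain ⟨θ, hθ⟩ := exists_isLocalMLEOutput (f := f) hr (fun i => x i + z i)
    (by linarith : q - b ≤ q - a)
  exact ⟨θ, q, hq, hθ⟩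

end output

section hoeffding

variable {Ω : Type*} {mΩ : MeasurableSpace Ω} {P : Measure Ω}

lemma measureReal_map_add {f : Measure ℝ} {lam : ℝ} {X : Ω → ℝ}
    (hX : HasLaw X (f.map (fun y => lam + y)) P) {A : Set ℝ} (hA : MeasurableSet A) :
    P.real {ω | X ω ∈ A} = f.real ((fun y => lam + y) ⁻¹' A) := by
  have h := hX.measureReal_eq (p := fun x => x ∈ A) hA
  rw [h]
  exact map_measureReal_apply (by fun_prop) hA

variable [IsProbabilityMeasure P]

/-- Hoeffding's inequality for the number of samples in a set. -/
lemma measureReal_le_card_filter_le {n : ℕ} {X : Fin n → Ω → ℝ} (hX : iIndepFun X P)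
    (hXm : ∀ i, AEMeasurable (X i) P) {A : Set ℝ} [DecidablePred (· ∈ A)] (hA : MeasurableSet A)
    {p t : ℝ} (hp : ∀ i, P.real {ω | X i ω ∈ A} ≤ p) (ht : 0 ≤ t) (hn : 0 < n) :
    P.real {ω | (p + t) * n ≤ ((Finset.univ.filter fun i => X i ω ∈ A).card : ℝ)} ≤
      Real.exp (-2 * n * t ^ 2) := by
  have hnR : (0 : ℝ) < n := by exact_mod_cast hn
  set g : ℝ → ℝ := A.indicator 1 with hg
  have hgm : Measurable g := measurable_one.indicator hA
  set Y : Fin n → Ω → ℝ := fun i ω => g (X i ω) with hY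
  have hYm : ∀ i, AEMeasurable (Y i) P := fun i => hgm.comp_aemeasurable (hXm i)
  have hYmem : ∀ i, ∀ᵐ ω ∂P, Y i ω ∈ Set.Icc (0 : ℝ) 1 := fun i => ae_of_all _ fun ω => by
    simp only [hY, hg]
    by_cases h : X i ω ∈ A <;> simp [h]
  have hmean : ∀ i, ∫ ω, Y i ω ∂P ≤ p := fun i => by
    refine le_trans (le_of_eq ?_) (hp i)
    have h1 : ∫ ω, Y i ω ∂P = ∫ x, g x ∂(P.map (X i)) :=
      (integral_map (hXm i) hgm.aestronglyMeasurable).symm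
    rw [h1, hg, integral_indicator_one hA, map_measureReal_apply_of_aemeasurable (hXm i) hA]
    rfl
  -- Hoeffding's lemma on `[0, 1]`: variance proxy `1 / 4`, whence the exponent `-2 n t²`.
  have hsub : ∀ i ∈ (Finset.univ : Finset (Fin n)),
      HasSubgaussianMGF (fun ω => Y i ω - ∫ ω, Y i ω ∂P) ((‖(1 : ℝ) - 0‖₊ / 2) ^ 2) P :=
    fun i _ => hasSubgaussianMGF_of_mem_Icc (hYm i) (hYmem i)
  have hind : iIndepFun (fun i ω => Y i ω - ∫ ω, Y i ω ∂P) P :=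
    hX.comp (fun i x => g x - ∫ ω, Y i ω ∂P) fun i => by fun_prop
  have h := HasSubgaussianMGF.measure_sum_ge_le_of_iIndepFun hind hsub
    (ε := t * n) (by positivity)
  refine (measureReal_mono fun ω hω => ?_).trans (h.trans_eq ?_)
  · simp only [Set.mem_ofPred_eq] at hω ⊢
    rw [Finset.sum_sub_distrib]
    have h1 : ∑ i, Y i ω = ((Finset.univ.filter fun i => X i ω ∈ A).card : ℝ) := by
      simp only [hY, hg, Set.indicator_apply, Pi.one_apply, Finset.sum_boole]
    have h2 : ∑ i : Fin n, ∫ ω, Y i ω ∂P ≤ n * p := by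
      refine (Finset.sum_le_sum fun i _ => hmean i).trans_eq ?_
      simp
    rw [h1]
    linarith
  · congr 1
    simp
    field_simp

/-- The initial interval contains `lam`, except with small probability. -/
lemma measureReal_window_miss_le {f : Measure ℝ} [IsProbabilityMeasure f] {n : ℕ} (hn : 0 < n)
    {X : Fin n → Ω → ℝ} {lam t α a b : ℝ} (ht : 0 < t) (hw : IsShortestWindow f t α a b)
    (hX : ∀ i, HasLaw (X i) (f.map (fun y => lam + y)) P) (hind : iIndepFun X P) :
    P.real {ω | ∃ q, IsSampleQuantile (fun i => X i ω) α q ∧ lam ∉ Set.Icc (q - b) (q - a)} ≤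
      2 * Real.exp (-2 * n * t ^ 2) := by
  classical
  have hXm : ∀ i, AEMeasurable (X i) P := fun i => (hX i).aemeasurable
  have h1 := measureReal_le_card_filter_le hind hXm (A := Set.Iio (lam + a)) measurableSet_Iio
    (p := α - t) (t := t) (fun i => by
      rw [measureReal_map_add (hX i) measurableSet_Iio]
      refine le_trans (le_of_eq ?_) hw.left.1
      congr 1
      ext y
      simp) ht.le hn
  have h2 := measureReal_le_card_filter_le hind hXm (A := Set.Ioi (lam + b)) measurableSet_Ioi
    (p := 1 - (α + t)) (t := t) (fun i => by
      rw [measureReal_map_add (hX i) measurableSet_Ioi]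
      have h3 : (fun y => lam + y) ⁻¹' Set.Ioi (lam + b) = (Set.Iic b)ᶜ := by
        ext y
        simp
      rw [h3, probReal_compl_eq_one_sub measurableSet_Iic]
      linarith [hw.right.2]) ht.le hn
  refine (measureReal_mono ?_).trans ((measureReal_union_le _ _).trans
    ((add_le_add h1 h2).trans_eq (by ring)))
  rintro ω ⟨q, ⟨hq1, hq2⟩, hnot⟩
  simp only [Set.mem_union, Set.mem_ofPred_eq]
  -- A miss means `q < lam + a`, with too many samples below `lam + a`, or `q > lam + b`, with too
  -- many above `lam + b`.
  by_cases hqa : q < lam + a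
  · left
    rw [sub_add_cancel]
    refine hq2.trans ?_
    exact_mod_cast Finset.card_le_card fun i hi => by
      simp only [Finset.mem_filter, Finset.mem_univ, true_and, Set.mem_Iio] at hi ⊢
      exact lt_of_le_of_lt hi hqa
  · right
    have hqb : lam + b < q := by
      by_contra! h
      exact hnot ⟨by linarith, by linarith⟩
    have h3 : (1 - (α + t) + t) * (n : ℝ) = n - α * n := by ring
    have h4 := Finset.card_filter_add_card_filter_not (s := (Finset.univ : Finset (Fin n)))
      (fun i => X i ω < q)
    have h5 : (Finset.univ.filter fun i => ¬ X i ω < q).card ≤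
        (Finset.univ.filter fun i => X i ω ∈ Set.Ioi (lam + b)).card :=
      Finset.card_le_card fun i hi => by
        simp only [Finset.mem_filter, Finset.mem_univ, true_and, Set.mem_Ioi, not_lt] at hi ⊢
        exact lt_of_lt_of_le hqb hi
    rw [Finset.card_univ, Fintype.card_fin] at h4
    have h6 : (n : ℝ) = ((Finset.univ.filter fun i => X i ω < q).card : ℝ) +
      ((Finset.univ.filter fun i => ¬ X i ω < q).card : ℝ) := by exact_mod_cast h4.symm
    have h7 : ((Finset.univ.filter fun i => ¬ X i ω < q).card : ℝ) ≤
      ((Finset.univ.filter fun i => X i ω ∈ Set.Ioi (lam + b)).card : ℝ) := by exact_mod_cast h5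
    rw [h3]
    linarith

end hoeffding

end

end LocationMLE

/-! ### Chernoff bounds and uniform sign control of the empirical score -/

namespace LocationMLE

noncomputable section

variable {Ω : Type*} {mΩ : MeasurableSpace Ω} {P : Measure Ω}

lemma hasLaw_sub_of_map_add {f : Measure ℝ} {lam : ℝ} {X : Ω → ℝ}
    (hX : HasLaw X (f.map (fun y => lam + y)) P) : HasLaw (fun ω => X ω - lam) f P := by
  have h : HasLaw (fun x : ℝ => x - lam) f (f.map (fun y => lam + y)) := by
    refine ⟨by fun_prop, ?_⟩
    rw [Measure.map_map (by fun_prop) (by fun_prop)]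
    simp [Function.comp_def]
  exact h.fun_comp hX

variable [IsProbabilityMeasure P]

/-- If two families are jointly independent, so is the family of pairs. -/
lemma iIndepFun_prodMk_of_sumElim {n : ℕ} {X Z : Fin n → Ω → ℝ}
    (hX : ∀ i, AEMeasurable (X i) P) (hZ : ∀ i, AEMeasurable (Z i) P)
    (h : iIndepFun (Sum.elim X Z) P) : iIndepFun (fun i ω => (X i ω, Z i ω)) P := by
  have hS : ∀ j, AEMeasurable (Sum.elim X Z j) P := by
    rintro (i | i)
    · exact hX i
    · exact hZ i
  have hprob : ∀ j, IsProbabilityMeasure (P.map (Sum.elim X Z j)) := fun j =>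
    Measure.isProbabilityMeasure_map (hS j)
  have hpX : ∀ i, IsProbabilityMeasure (P.map (X i)) := fun i => hprob (Sum.inl i)
  have hpZ : ∀ i, IsProbabilityMeasure (P.map (Z i)) := fun i => hprob (Sum.inr i)
  have hlaw : ∀ j, HasLaw (Sum.elim X Z j) (P.map (Sum.elim X Z j)) P := fun j => ⟨hS j, rfl⟩
  have hpair : ∀ i, HasLaw (fun ω => (X i ω, Z i ω)) ((P.map (X i)).prod (P.map (Z i))) P := fun i =>
    (indepFun_iff_hasLaw_prodMk_prod ⟨hX i, rfl⟩ ⟨hZ i, rfl⟩).1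
      (h.indepFun (i := Sum.inl i) (j := Sum.inr i) (by simp))
  rw [iIndepFun_iff_hasLaw_pi_pi hpair]
  -- The joint law is a product over `Fin n ⊕ Fin n`; it is regrouped as a product of two families,
  -- then as one family of pairs.
  have h1 := h.hasLaw_pi hlaw
  have h2 := (measurePreserving_sumPiEquivProdPi (fun j => P.map (Sum.elim X Z j))).comp_hasLaw h1
  have h3 := (measurePreserving_arrowProdEquivProdArrow ℝ ℝ (Fin n) (fun i => P.map (X i))
    (fun i => P.map (Z i))).symm.comp_hasLaw h2
  exact h3

variable {f : Measure ℝ} {r : ℝ} {n : ℕ}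

lemma hasLaw_pair {lam : ℝ} {X Z : Ω → ℝ} (hX : HasLaw X (f.map (fun y => lam + y)) P)
    (hZ : HasLaw Z (gaussianReal 0 (r ^ 2).toNNReal) P) (h : IndepFun X Z P) :
    HasLaw (fun ω => (X ω - lam, Z ω)) (jointLaw f r) P := by
  refine (indepFun_iff_hasLaw_prodMk_prod (hasLaw_sub_of_map_add hX) hZ).1 ?_
  exact h.comp (φ := fun x => x - lam) (ψ := id) (by fun_prop) measurable_id

variable [IsProbabilityMeasure f]

/-- Chernoff's bound for the empirical score at distance `|ε|` from the true parameter. -/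
lemma mgf_empiricalScore_le (hr : 0 < r) {lam : ℝ} {X Z : Fin n → Ω → ℝ}
    (hX : ∀ i, HasLaw (X i) (f.map (fun y => lam + y)) P)
    (hZ : ∀ i, HasLaw (Z i) (gaussianReal 0 (r ^ 2).toNNReal) P)
    (hind : iIndepFun (Sum.elim X Z) P) {ε : ℝ} (hε : |ε| ≤ r) :
    Integrable (fun ω => Real.exp (-ε * empiricalScore f r (fun i => X i ω + Z i ω) (lam + ε))) P ∧
    mgf (fun ω => empiricalScore f r (fun i => X i ω + Z i ω) (lam + ε)) P (-ε) ≤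
      Real.exp (n * (-(ε ^ 2 * fisherInfo f r / 2)
        + scoreConst * |ε| ^ 3 * √(fisherInfo f r) / r ^ 2)) := by
  have hs := measurable_score (f := f) hr
  set T : Fin n → Ω → ℝ := fun i ω => score f r (X i ω + Z i ω - (lam + ε)) with hT
  have hXm : ∀ i, AEMeasurable (X i) P := fun i => (hX i).aemeasurable
  have hZm : ∀ i, AEMeasurable (Z i) P := fun i => (hZ i).aemeasurable
  have hTm : ∀ i, AEMeasurable (T i) P := fun i =>
    hs.comp_aemeasurable (((hXm i).add (hZm i)).sub_const _)
  have hTind : iIndepFun T P :=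
    (iIndepFun_prodMk_of_sumElim hXm hZm hind).comp
      (fun _ p => score f r (p.1 + p.2 - (lam + ε))) fun _ => by fun_prop
  have hpair : ∀ i, HasLaw (fun ω => (X i ω - lam, Z i ω)) (jointLaw f r) P := fun i =>
    hasLaw_pair (hX i) (hZ i) (hind.indepFun (i := Sum.inl i) (j := Sum.inr i) (by simp))
  have hTeq : ∀ i ω, Real.exp (-ε * T i ω) =
      (fun p : ℝ × ℝ => Real.exp (-ε * score f r (p.1 + p.2 - ε))) (X i ω - lam, Z i ω) :=
    fun i ω => by
      simp only [hT]
      congr 3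
      ring
  have hTint : ∀ i, Integrable (fun ω => Real.exp (-ε * T i ω)) P := fun i => by
    have h := integrable_exp_shifted_score (f := f) hr ε (-ε)
    rw [← (hpair i).map_eq, integrable_map_measure (Measurable.aestronglyMeasurable (by fun_prop))
      (hpair i).aemeasurable] at h
    exact h.congr (ae_of_all _ fun ω => (hTeq i ω).symm)
  have hTmgf : ∀ i, mgf (T i) P (-ε) ≤ Real.exp (-(ε ^ 2 * fisherInfo f r / 2)
        + scoreConst * |ε| ^ 3 * √(fisherInfo f r) / r ^ 2) := fun i => by
    have h := integral_exp_shifted_score_le (f := f) hr hε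
    have h2 : mgf (T i) P (-ε) =
        ∫ p, Real.exp (-ε * score f r (p.1 + p.2 - ε)) ∂(jointLaw f r) := by
      rw [← (hpair i).integral_comp (Measurable.aestronglyMeasurable (by fun_prop))]
      exact integral_congr_ae (ae_of_all _ fun ω => hTeq i ω)
    rw [h2]
    refine h.trans (le_trans (le_of_eq ?_) (Real.add_one_le_exp _))
    ring
  have hsum : (fun ω => empiricalScore f r (fun i => X i ω + Z i ω) (lam + ε)) = ∑ i, T i := by
    ext ω
    simp [empiricalScore, hT]
  constructor
  · have hmk : ∀ i, T i =ᵐ[P] (hTm i).mk (T i) := fun i => (hTm i).ae_eq_mk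
    have h := (hTind.congr hmk).integrable_exp_mul_sum (fun i => (hTm i).measurable_mk)
      (s := Finset.univ) (t := -ε) fun i _ => (hTint i).congr (by
        filter_upwards [hmk i] with ω hω
        rw [hω])
    refine h.congr ?_
    filter_upwards [ae_all_iff.2 hmk] with ω hω
    rw [congrFun hsum ω, Finset.sum_apply, Finset.sum_apply]
    simp_rw [hω]
  · rw [hsum, hTind.mgf_sum₀ hTm]
    refine (Finset.prod_le_prod (fun i _ => mgf_nonneg) fun i _ => hTmgf i).trans_eq ?_
    rw [Finset.prod_const, Finset.card_univ, Fintype.card_fin, ← Real.exp_nat_mul]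

/-- Markov's inequality with exponent equal to the shift. The slack `τ` leaves room for moving off
the net. -/
lemma measureReal_empiricalScore_le_le (hr : 0 < r) {lam : ℝ} {X Z : Fin n → Ω → ℝ}
    (hX : ∀ i, HasLaw (X i) (f.map (fun y => lam + y)) P)
    (hZ : ∀ i, HasLaw (Z i) (gaussianReal 0 (r ^ 2).toNNReal) P)
    (hind : iIndepFun (Sum.elim X Z) P) {ε : ℝ} (hε0 : 0 ≤ ε) (hε : ε ≤ r) (τ : ℝ) :
    P.real {ω | empiricalScore f r (fun i => X i ω + Z i ω) (lam + ε) ≤ τ} ≤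
      Real.exp (ε * τ + n * (-(ε ^ 2 * fisherInfo f r / 2)
        + scoreConst * ε ^ 3 * √(fisherInfo f r) / r ^ 2)) := by
  obtain ⟨h1, h2⟩ := mgf_empiricalScore_le hr hX hZ hind (by rwa [abs_of_nonneg hε0] : |ε| ≤ r)
  refine (measure_le_le_exp_mul_mgf τ (by linarith) h1).trans ?_
  rw [Real.exp_add, neg_neg]
  rw [abs_of_nonneg hε0] at h2
  gcongr

lemma measureReal_le_empiricalScore_le (hr : 0 < r) {lam : ℝ} {X Z : Fin n → Ω → ℝ}
    (hX : ∀ i, HasLaw (X i) (f.map (fun y => lam + y)) P)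
    (hZ : ∀ i, HasLaw (Z i) (gaussianReal 0 (r ^ 2).toNNReal) P)
    (hind : iIndepFun (Sum.elim X Z) P) {ε : ℝ} (hε0 : 0 ≤ ε) (hε : ε ≤ r) (τ : ℝ) :
    P.real {ω | -τ ≤ empiricalScore f r (fun i => X i ω + Z i ω) (lam - ε)} ≤
      Real.exp (ε * τ + n * (-(ε ^ 2 * fisherInfo f r / 2)
        + scoreConst * ε ^ 3 * √(fisherInfo f r) / r ^ 2)) := by
  obtain ⟨h1, h2⟩ := mgf_empiricalScore_le hr hX hZ hind
    (by rwa [abs_neg, abs_of_nonneg hε0] : |-ε| ≤ r)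
  simp only [neg_neg, ← sub_eq_add_neg] at h1 h2
  refine (measure_ge_le_exp_mul_mgf (-τ) hε0 h1).trans ?_
  rw [Real.exp_add, neg_mul_neg]
  rw [abs_neg, abs_of_nonneg hε0, neg_sq] at h2
  gcongr

/-- Only increases are controlled, which is enough: a value above `τ` at a net point stays positive
slightly to its left, and symmetrically for negative values to the right. -/
lemma empiricalScore_sub_le (hr : 0 < r) (x : Fin n → ℝ) {θ θ' : ℝ} (h : θ ≤ θ') :
    empiricalScore f r x θ' - empiricalScore f r x θ ≤ n * ((θ' - θ) / r ^ 2) := by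
  rw [empiricalScore, empiricalScore, ← Finset.sum_sub_distrib]
  refine (Finset.sum_le_sum fun i _ => score_sub_le (f := f) hr
    (by linarith : x i - θ' ≤ x i - θ)).trans_eq ?_
  simp [sub_sub_sub_cancel_left]

/-- Uniform control of the sign of the empirical score on both sides of the true parameter. -/
lemma measureReal_wrong_sign_le (hr : 0 < r) {lam : ℝ} {X Z : Fin n → Ω → ℝ}
    (hX : ∀ i, HasLaw (X i) (f.map (fun y => lam + y)) P)
    (hZ : ∀ i, HasLaw (Z i) (gaussianReal 0 (r ^ 2).toNNReal) P)
    (hind : iIndepFun (Sum.elim X Z) P) {ε₀ D η ν : ℝ} {N : ℕ} (hε₀ : 0 < ε₀) (hεD : ε₀ ≤ D)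
    (hDr : D ≤ r) (hN : 0 < N)
    (hη : 2 * scoreConst * D ≤ η * (r ^ 2 * √(fisherInfo f r)))
    (hν : 2 * D ≤ ν * (N * (r ^ 2 * (ε₀ * fisherInfo f r)))) (hην : η + ν ≤ 1) :
    P.real {ω | ¬ ((∀ ε, ε₀ ≤ ε → ε ≤ D →
          0 < empiricalScore f r (fun i => X i ω + Z i ω) (lam + ε)) ∧
        ∀ ε, ε₀ ≤ ε → ε ≤ D → empiricalScore f r (fun i => X i ω + Z i ω) (lam - ε) < 0)} ≤
      2 * N * Real.exp (-(n * ε₀ ^ 2 * fisherInfo f r / 2 * (1 - η - ν))) := by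
  set I := fisherInfo f r with hI
  have hI0 : 0 ≤ I := fisherInfo_nonneg hr
  have hNR : (0 : ℝ) < N := by exact_mod_cast hN
  have hsI : √I * √I = I := Real.mul_self_sqrt hI0
  set h := (D - ε₀) / N with hh
  have hh0 : 0 ≤ h := div_nonneg (by linarith) hNR.le
  have hNh : N * h = D - ε₀ := by rw [hh]; field_simp
  -- `τ` is the largest increase of the empirical score over one mesh width. The net starts at `j +
  -- 1`, so that every `ε` in `[ε₀, D]` has a net point at or above it within `h`, the last one
  -- being `D`.
  set τ := n * (h / r ^ 2) with hτ
  set e : ℕ → ℝ := fun j => ε₀ + (j + 1) * h with he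
  have heD : ∀ j < N, e j ≤ D := fun j hj => by
    have : ((j : ℝ) + 1) ≤ N := by exact_mod_cast hj
    simp only [he]
    nlinarith
  have heε : ∀ j, ε₀ ≤ e j := fun j => by
    simp only [he]
    nlinarith [mul_nonneg (by positivity : (0 : ℝ) ≤ (j : ℝ) + 1) hh0]
  have hbound : ∀ j < N, e j * τ + n * (-(e j ^ 2 * I / 2) + scoreConst * e j ^ 3 * √I / r ^ 2) ≤
      -(n * ε₀ ^ 2 * I / 2 * (1 - η - ν)) := fun j hj => by
    have hj1 := heε j
    have hj2 := heD j hj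
    set x := e j
    have hx0 : 0 < x := hε₀.trans_le hj1
    have hr2 : 0 < r ^ 2 := by positivity
    have b1 : h / r ^ 2 ≤ ν * (x * I) / 2 := by
      rw [div_le_iff₀ hr2, hh, div_le_iff₀ hNR]
      -- Nonnegativity of `ν * I` is forced by `hν`, whose left side is positive.
      have hν0 : 0 ≤ ν * I := by
        by_contra! hc
        have h1 : ν * (N * (r ^ 2 * (ε₀ * I))) = (ν * I) * (N * (r ^ 2 * ε₀)) := by ring
        have h2 : (ν * I) * (N * (r ^ 2 * ε₀)) < 0 := mul_neg_of_neg_of_pos hc (by positivity)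
        linarith
      have h3 : ν * I * ε₀ ≤ ν * I * x := by gcongr
      have h4 : ν * (N * (r ^ 2 * (ε₀ * I))) ≤ ν * (x * I) * r ^ 2 * N := by
        calc ν * (N * (r ^ 2 * (ε₀ * I))) = ν * I * ε₀ * (r ^ 2 * N) := by ring
          _ ≤ ν * I * x * (r ^ 2 * N) := by gcongr
          _ = _ := by ring
      linarith
    have b2 : scoreConst * x ^ 3 * √I / r ^ 2 ≤ η * (x ^ 2 * I / 2) := by
      rw [div_le_iff₀ hr2]
      have hc := scoreConst_pos
      have h1 : 2 * scoreConst * x ≤ η * (r ^ 2 * √I) :=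
        le_trans (by gcongr) hη
      calc scoreConst * x ^ 3 * √I = (2 * scoreConst * x) * (x ^ 2 * √I / 2) := by ring
        _ ≤ (η * (r ^ 2 * √I)) * (x ^ 2 * √I / 2) := by gcongr
        _ = η * (x ^ 2 * (√I * √I) / 2) * r ^ 2 := by ring
        _ = _ := by rw [hsI]
    have b3 : x * (h / r ^ 2) ≤ ν * (x ^ 2 * I / 2) := by
      calc x * (h / r ^ 2) ≤ x * (ν * (x * I) / 2) := by gcongr
        _ = _ := by ring
    have b4 : ε₀ ^ 2 * I / 2 * (1 - η - ν) ≤ x ^ 2 * I / 2 * (1 - η - ν) := by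
      have : 0 ≤ 1 - η - ν := by linarith
      gcongr
    have hn0 : (0 : ℝ) ≤ n := by positivity
    calc x * τ + n * (-(x ^ 2 * I / 2) + scoreConst * x ^ 3 * √I / r ^ 2)
        = n * (x * (h / r ^ 2) + (-(x ^ 2 * I / 2) + scoreConst * x ^ 3 * √I / r ^ 2)) := by
          rw [hτ]; ring
      _ ≤ n * (-(ε₀ ^ 2 * I / 2 * (1 - η - ν))) := by
          gcongr
          linarith
      _ = _ := by ring
  set A : ℕ → Set Ω := fun j =>
    {ω | empiricalScore f r (fun i => X i ω + Z i ω) (lam + e j) ≤ τ} with hA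
  set B : ℕ → Set Ω := fun j =>
    {ω | -τ ≤ empiricalScore f r (fun i => X i ω + Z i ω) (lam - e j)} with hB
  have hcover : ∀ ε, ε₀ ≤ ε → ε ≤ D → ∃ j < N, ε ≤ e j ∧ e j - ε ≤ h := fun ε h1 h2 => by
    rcases eq_or_lt_of_le hh0 with h0 | h0
    -- Degenerate mesh: `D = ε₀`.
    · refine ⟨0, hN, ?_, ?_⟩ <;> simp only [he] <;> nlinarith
    · rcases eq_or_lt_of_le h1 with h3 | h3
      · refine ⟨0, hN, ?_, ?_⟩ <;> simp only [he] <;> push_cast <;> linarith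
      · have hx : 0 < (ε - ε₀) / h := div_pos (by linarith) h0
        obtain ⟨j, hj⟩ := Nat.exists_eq_add_of_le' (Nat.one_le_ceil_iff.2 hx)
        have hc1 := Nat.le_ceil ((ε - ε₀) / h)
        have hc2 := Nat.ceil_lt_add_one hx.le
        rw [hj] at hc1 hc2
        push_cast at hc1 hc2
        rw [div_le_iff₀ h0] at hc1
        have hc3 : (j : ℝ) * h < ε - ε₀ := by
          rw [← lt_div_iff₀ h0]; linarith
        have hjN : j < N := by
          have : (j : ℝ) < N := by
            by_contra! hc
            nlinarith
          exact_mod_cast this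
        refine ⟨j, hjN, ?_, ?_⟩ <;> simp only [he] <;> linarith
  have hsub : {ω | ¬ ((∀ ε, ε₀ ≤ ε → ε ≤ D →
          0 < empiricalScore f r (fun i => X i ω + Z i ω) (lam + ε)) ∧
        ∀ ε, ε₀ ≤ ε → ε ≤ D → empiricalScore f r (fun i => X i ω + Z i ω) (lam - ε) < 0)} ⊆
      (⋃ j ∈ Finset.range N, A j) ∪ ⋃ j ∈ Finset.range N, B j := by
    intro ω hω
    by_contra hnot
    simp only [Set.mem_union, Set.mem_iUnion, Finset.mem_range, not_or, not_exists, hA, hB,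
      Set.mem_ofPred_eq, not_le] at hnot
    refine hω ⟨fun ε h1 h2 => ?_, fun ε h1 h2 => ?_⟩
    · obtain ⟨j, hj, h3, h4⟩ := hcover ε h1 h2
      have h5 := empiricalScore_sub_le (f := f) hr (fun i => X i ω + Z i ω)
        (by linarith : lam + ε ≤ lam + e j)
      have h6 := hnot.1 j hj
      have h7 : n * ((lam + e j - (lam + ε)) / r ^ 2) ≤ τ := by
        rw [hτ]; gcongr; linarith
      linarith
    · obtain ⟨j, hj, h3, h4⟩ := hcover ε h1 h2
      have h5 := empiricalScore_sub_le (f := f) hr (fun i => X i ω + Z i ω)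
        (by linarith : lam - e j ≤ lam - ε)
      have h6 := hnot.2 j hj
      have h7 : n * ((lam - ε - (lam - e j)) / r ^ 2) ≤ τ := by
        rw [hτ]; gcongr; linarith
      linarith
  set M := Real.exp (-(n * ε₀ ^ 2 * I / 2 * (1 - η - ν))) with hM
  have hAle : ∀ j ∈ Finset.range N, P.real (A j) ≤ M := fun j hj => by
    have hj' := Finset.mem_range.1 hj
    refine (measureReal_empiricalScore_le_le hr hX hZ hind (hε₀.le.trans (heε j))
      ((heD j hj').trans hDr) τ).trans ?_
    exact Real.exp_le_exp.2 (hbound j hj')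
  have hBle : ∀ j ∈ Finset.range N, P.real (B j) ≤ M := fun j hj => by
    have hj' := Finset.mem_range.1 hj
    refine (measureReal_le_empiricalScore_le hr hX hZ hind (hε₀.le.trans (heε j))
      ((heD j hj').trans hDr) τ).trans ?_
    exact Real.exp_le_exp.2 (hbound j hj')
  refine (measureReal_mono hsub).trans ((measureReal_union_le _ _).trans ?_)
  have h1 := (measureReal_biUnion_finset_le (μ := P) (Finset.range N) A).trans
    (Finset.sum_le_sum hAle)
  have h2 := (measureReal_biUnion_finset_le (μ := P) (Finset.range N) B).trans
    (Finset.sum_le_sum hBle)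
  rw [Finset.sum_const, Finset.card_range, nsmul_eq_mul] at h1 h2
  linarith

end

end LocationMLE

/-! ### Choice of the constants -/

namespace LocationMLE

noncomputable section

/-- One factor `A` pays for the loss `1 - y`, as `(1 + 2y)(1 - y) ≥ 1` for `0 ≤ y ≤ 1/2`; the other
supplies the surplus `C x` that covers `C₃ (1 + x)`. -/
lemma sq_mul_one_sub_ge {x A C C₃ g y : ℝ} (hx : 1 ≤ x) (hy0 : 0 ≤ y) (hy1 : y ≤ 1 / 2)
    (hC₃ : 0 ≤ C₃) (hC : 2 * C₃ ≤ C) (hg : 0 ≤ C * g) (hA : A = (1 + C * g + C / x) * x)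
    (hy : 2 * y ≤ C * g + C / x) : x ^ 2 + C₃ * (1 + x) ≤ A ^ 2 * (1 - y) := by
  have hx0 : 0 < x := by linarith
  have hC0 : 0 ≤ C := by linarith
  have h1 : x * (1 + 2 * y) ≤ A := by
    rw [hA]; nlinarith
  have h2 : x ≤ A * (1 - y) := by
    have : x ≤ x * (1 + 2 * y) * (1 - y) := by
      have : 1 ≤ (1 + 2 * y) * (1 - y) := by nlinarith
      nlinarith
    exact this.trans (by gcongr; linarith)
  have h3 : x + C ≤ A := by
    have : A = x + C * g * x + C := by rw [hA]; field_simp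
    nlinarith
  have hA0 : 0 ≤ A := by linarith
  calc x ^ 2 + C₃ * (1 + x) ≤ x ^ 2 + C * x := by nlinarith
    _ = (x + C) * x := by ring
    _ ≤ A * (A * (1 - y)) := by gcongr
    _ = _ := by ring

/-- The quantity that governs all error terms is at most `1 / 4`, and of order `(L / n) ^ (1 / 4)`
once `L ≥ 1`. -/
lemma width_error_le {c₁ c₂ K L w : ℝ} {n : ℕ} (hc₁ : 0 < c₁) (hc₂ : 0 < c₂) (hK : 1 ≤ K)
    (hL : 0 < L) (hw0 : 0 ≤ w)
    (hn : 32 * (768 * K * (1 / c₁ + 14) ^ 2 * Real.exp (2 * c₂)) ^ 4 * (L + Real.log 4) ≤ n)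
    (hw1 : c₁ * (L / n) ^ (1 / 8 : ℝ) * w ≤ 1)
    (hw2 : w ≤ 1 / c₁ * Real.exp (c₂ * √L)) :
    64 * K * √(2 * (L + Real.log 4) / n) * (w * (w + 14)) ≤ 1 / 4 ∧
    (1 ≤ L → 64 * K * √(2 * (L + Real.log 4) / n) * (w * (w + 14)) ≤
      192 * K * (1 / c₁ + 14) ^ 2 * (L / n) ^ (1 / 4 : ℝ)) := by
  set Γ := 1 / c₁ + 14 with hΓ
  set E := 768 * K * Γ ^ 2 * Real.exp (2 * c₂) with hE
  have hΓ1 : 1 ≤ Γ := by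
    have : 0 < 1 / c₁ := by positivity
    rw [hΓ]; linarith
  have hexp1 : 1 ≤ Real.exp (2 * c₂) := Real.one_le_exp (by positivity)
  have hΓ2 : 1 ≤ Γ ^ 2 := one_le_pow₀ hΓ1
  have hKG : 1 ≤ K * Γ ^ 2 := one_le_mul_of_one_le_of_one_le hK hΓ2
  have hE1 : 1 ≤ E := by
    have : 1 ≤ K * Γ ^ 2 * Real.exp (2 * c₂) := one_le_mul_of_one_le_of_one_le hKG hexp1
    rw [hE]; linarith
  have hlog4 : 0 < Real.log 4 := Real.log_pos (by norm_num)
  have hlog4' : Real.log 4 ≤ 2 := by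
    have : Real.log 4 = 2 * Real.log 2 := by
      rw [show (4 : ℝ) = 2 ^ 2 by norm_num, Real.log_pow]; norm_num
    linarith [Real.log_two_lt_d9]
  have hn0 : (0 : ℝ) < n := lt_of_lt_of_le (by positivity) hn
  have hγ0 : 0 < L / n := by positivity
  have hL4 : (L + Real.log 4) / n ≤ 1 / (32 * E ^ 4) := by
    rw [div_le_div_iff₀ hn0 (by positivity)]
    linarith
  have hγE : L / n ≤ 1 / E ^ 4 := by
    have h1 : L / n ≤ (L + Real.log 4) / n := by gcongr; linarith
    have h2 : 1 / (32 * E ^ 4) ≤ 1 / E ^ 4 := by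
      apply one_div_le_one_div_of_le (by positivity)
      linarith [pow_pos (by linarith : 0 < E) 4]
    linarith
  have hlarge : 1 ≤ L → 64 * K * √(2 * (L + Real.log 4) / n) * (w * (w + 14)) ≤
      192 * K * Γ ^ 2 * (L / n) ^ (1 / 4 : ℝ) := fun h1 => by
    set γ := L / n with hγ
    -- The window radius is of order `g⁴`, while `w` and `w + 14` each cost a factor `1 / g`; what
    -- remains is `g² = γ^(1/4)`.
    set g := γ ^ (1 / 8 : ℝ) with hg
    have hg0 : 0 < g := Real.rpow_pos_of_pos hγ0 _
    have hg4 : g ^ 4 = √γ := by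
      rw [hg, ← Real.rpow_natCast, ← Real.rpow_mul hγ0.le, Real.sqrt_eq_rpow]; norm_num
    have hg2 : γ ^ (1 / 4 : ℝ) = g ^ 2 := by
      rw [hg, ← Real.rpow_natCast, ← Real.rpow_mul hγ0.le]; norm_num
    have hgle : g ≤ 1 := Real.rpow_le_one hγ0.le
      (hγE.trans (by rw [div_le_one (by positivity)]; exact one_le_pow₀ hE1)) (by norm_num)
    have ht : √(2 * (L + Real.log 4) / n) ≤ 3 * g ^ 4 := by
      rw [hg4]
      calc √(2 * (L + Real.log 4) / n) ≤ √(3 ^ 2 * γ) := by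
            apply Real.sqrt_le_sqrt
            rw [hγ, ← mul_div_assoc]
            exact div_le_div_of_nonneg_right (by linarith) hn0.le
        _ = 3 * √γ := by rw [Real.sqrt_mul (by norm_num), Real.sqrt_sq (by norm_num)]
    have hwg : w * g ≤ 1 / c₁ := by
      rw [le_div_iff₀ hc₁]; linarith
    have hwg2 : (w + 14) * g ≤ Γ := by rw [hΓ, add_mul]; linarith
    have hwg1 : w * g ≤ Γ := hwg.trans (by rw [hΓ]; linarith)
    rw [hg2]
    calc 64 * K * √(2 * (L + Real.log 4) / n) * (w * (w + 14))
        ≤ 64 * K * (3 * g ^ 4) * (w * (w + 14)) := by gcongr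
      _ = 192 * K * g ^ 2 * ((w * g) * ((w + 14) * g)) := by ring
      _ ≤ 192 * K * g ^ 2 * (Γ * Γ) := by gcongr
      _ = _ := by ring
  refine ⟨?_, hlarge⟩
  rcases le_or_gt 1 L with h1 | h1
  · refine (hlarge h1).trans ?_
    have h2 : (L / n) ^ (1 / 4 : ℝ) ≤ 1 / E := by
      calc (L / n) ^ (1 / 4 : ℝ) ≤ (1 / E ^ 4) ^ (1 / 4 : ℝ) :=
            Real.rpow_le_rpow hγ0.le hγE (by norm_num)
        _ = 1 / E := by
            rw [← one_div_pow, ← Real.rpow_natCast, ← Real.rpow_mul (by positivity)]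
            norm_num
    have h3 : 192 * K * Γ ^ 2 ≤ E / 4 := by
      have : 192 * K * Γ ^ 2 * 1 ≤ 192 * K * Γ ^ 2 * Real.exp (2 * c₂) := by gcongr
      rw [hE]
      linarith
    calc 192 * K * Γ ^ 2 * (L / n) ^ (1 / 4 : ℝ) ≤ E / 4 * (1 / E) := by gcongr
      _ = 1 / 4 := by field_simp
  -- For `L < 1` the radius is governed by `log 4` rather than `L`, so a power of `L / n` is out of
  -- reach; but `w` is bounded by a constant and a large `n` suffices.
  · have hsq : √L ≤ 1 := by rw [Real.sqrt_le_one]; exact h1.le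
    have hw3 : w + 14 ≤ Γ * Real.exp c₂ := by
      have h2 : Real.exp (c₂ * √L) ≤ Real.exp c₂ :=
        Real.exp_le_exp.2 (mul_le_of_le_one_right hc₂.le hsq)
      have h3 : 1 ≤ Real.exp c₂ := Real.one_le_exp hc₂.le
      have h4 : w ≤ 1 / c₁ * Real.exp c₂ := hw2.trans (by gcongr)
      rw [hΓ, add_mul]; linarith
    have hww : w * (w + 14) ≤ Γ ^ 2 * Real.exp (2 * c₂) := by
      have h2 : Real.exp (2 * c₂) = Real.exp c₂ ^ 2 := by rw [← Real.exp_nat_mul]; norm_num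
      rw [h2, ← mul_pow, sq]
      gcongr
      linarith
    have ht : √(2 * (L + Real.log 4) / n) ≤ 1 / E := by
      rw [Real.sqrt_le_left (by positivity)]
      calc 2 * (L + Real.log 4) / n = 2 * ((L + Real.log 4) / n) := by ring
        _ ≤ 2 * (1 / (32 * E ^ 4)) := by gcongr
        _ ≤ (1 / E) ^ 2 := by
          rw [one_div_pow, mul_one_div, div_le_div_iff₀ (by positivity) (by positivity)]
          have h5 : E ^ 2 ≤ E ^ 4 := pow_le_pow_right₀ hE1 (by norm_num)
          linarith [pow_pos (by linarith : 0 < E) 2]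
    calc 64 * K * √(2 * (L + Real.log 4) / n) * (w * (w + 14))
        ≤ 64 * K * (1 / E) * (Γ ^ 2 * Real.exp (2 * c₂)) := by gcongr
      _ = (E / 12) * (1 / E) := by rw [hE]; ring
      _ = 1 / 12 := by field_simp
      _ ≤ 1 / 4 := by norm_num

/-- Base 2 is traded for the weaker but more convenient base `e`. -/
lemma le_exp_of_two_rpow_mul_le {c₁ w y : ℝ} (hc₁ : 0 < c₁) (hw0 : 0 ≤ w) (hy : 0 ≤ y)
    (h1 : c₁ * (2 : ℝ) ^ (-y) * w ≤ 1) : w ≤ 1 / c₁ * Real.exp y := by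
  have h2 : Real.exp (-y) ≤ (2 : ℝ) ^ (-y) := by
    rw [Real.rpow_def_of_pos (by norm_num)]
    apply Real.exp_le_exp.2
    nlinarith [Real.log_two_lt_d9]
  have h3 : c₁ * Real.exp (-y) * w ≤ 1 := le_trans (by gcongr) h1
  rw [Real.exp_neg] at h3
  have h4 := Real.exp_pos y
  rw [div_mul_eq_mul_div, one_mul, le_div_iff₀ hc₁]
  calc w * c₁ = (c₁ * (Real.exp y)⁻¹ * w) * Real.exp y := by field_simp
    _ ≤ 1 * Real.exp y := by gcongr
    _ = _ := one_mul _

/-- The number of points of the net is at most `exp (O(1 + √L))`. -/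
lemma exists_net_size {L w c₁ c₂ : ℝ} (hc₁ : 0 < c₁) (hc₂ : 0 < c₂) (hL : 0 < L) (hw0 : 0 ≤ w)
    (hw2 : w ≤ 1 / c₁ * Real.exp (c₂ * √L)) :
    ∃ N : ℕ, 0 < N ∧ 64 * (w * (w + 14)) ≤ 1 / (4 * √(L + 1)) * N ∧ (4 : ℝ) * N ≤
      Real.exp ((Real.log (1032 * (1 / c₁ + 14) ^ 2) + 2 * c₂ + 1) * (1 + √L)) := by
  set Γ := 1 / c₁ + 14 with hΓ
  set x := √L with hx
  have hx0 : 0 < x := Real.sqrt_pos.2 hL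
  have hxL : x ^ 2 = L := Real.sq_sqrt hL.le
  have hΓ1 : 14 ≤ Γ := by
    have : 0 < 1 / c₁ := by positivity
    rw [hΓ]; linarith
  have hΓ2 : 1 ≤ Γ ^ 2 := one_le_pow₀ (by linarith)
  have hlogΓ : 0 ≤ Real.log (1032 * Γ ^ 2) := Real.log_nonneg (by linarith)
  have hs1 : 1 ≤ √(L + 1) := by rw [Real.one_le_sqrt]; linarith
  have h1 := Nat.ceil_lt_add_one (by positivity : 0 ≤ 256 * (w * (w + 14)) * √(L + 1))
  have h1' := Nat.le_ceil (256 * (w * (w + 14)) * √(L + 1))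
  refine ⟨⌈256 * (w * (w + 14)) * √(L + 1)⌉₊ + 1, Nat.succ_pos _, ?_, ?_⟩
  · rw [div_mul_eq_mul_div, one_mul, le_div_iff₀ (by positivity)]
    push_cast
    linarith
  have h4 : √(L + 1) ≤ Real.exp x := by
    have : √(L + 1) ≤ x + 1 := by
      rw [Real.sqrt_le_left (by linarith)]
      nlinarith
    linarith [Real.add_one_le_exp x]
  set F := Real.exp (c₂ * x) with hF
  have hF1 : 1 ≤ F := Real.one_le_exp (by positivity)
  have h5 : w + 14 ≤ Γ * F := by
    rw [hΓ, add_mul]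
    linarith
  have h6 : w * (w + 14) ≤ (Γ * F) * (Γ * F) := by
    gcongr
    linarith
  have h7 : 1 ≤ Γ ^ 2 * F ^ 2 * Real.exp x :=
    one_le_mul_of_one_le_of_one_le (one_le_mul_of_one_le_of_one_le hΓ2 (one_le_pow₀ hF1))
      (Real.one_le_exp hx0.le)
  have h8 : 256 * (w * (w + 14)) * √(L + 1) ≤ 256 * ((Γ * F) * (Γ * F)) * Real.exp x := by
    gcongr
  have h9 : 256 * ((Γ * F) * (Γ * F)) * Real.exp x = 256 * (Γ ^ 2 * F ^ 2 * Real.exp x) := by ring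
  push_cast
  calc 4 * ((⌈256 * (w * (w + 14)) * √(L + 1)⌉₊ : ℝ) + 1)
      ≤ 1032 * (Γ ^ 2 * F ^ 2 * Real.exp x) := by linarith
    _ = 1032 * Γ ^ 2 * (F ^ 2 * Real.exp x) := by ring
    _ = Real.exp (Real.log (1032 * Γ ^ 2) + (2 * (c₂ * x) + x)) := by
        rw [Real.exp_add, Real.exp_log (by positivity), Real.exp_add, hF, ← Real.exp_nat_mul]
        norm_num
    _ ≤ _ := by
        apply Real.exp_le_exp.2
        nlinarith [mul_nonneg hlogΓ hx0.le]

/-- The surplus `C₃ (1 + √L)` pays for the union bound over the net. For `L < 1` the term `C / √L`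
alone is enough, since it makes `√L` times the accuracy factor at least `C`. -/
lemma exponent_ge {L C C₃ g η ν : ℝ} (hL : 0 < L) (hg : 0 ≤ g) (hC₃ : 0 ≤ C₃)
    (hC : 2 + 2 * C₃ ≤ C) (hη0 : 0 ≤ η) (hη1 : η ≤ 1 / 4) (hη2 : 1 ≤ L → 2 * η ≤ C * g)
    (hν0 : 0 ≤ ν) (hν1 : ν ≤ 1 / 4) (hν2 : 2 * ν * √L ≤ C) :
    L + C₃ * (1 + √L) ≤ L * (1 + C * g + C / √L) ^ 2 * (1 - η - ν) := by
  set x := √L with hx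
  have hx0 : 0 < x := Real.sqrt_pos.2 hL
  have hxL : x ^ 2 = L := Real.sq_sqrt hL.le
  have hC0 : 0 < C := by linarith
  have e1 : L * (1 + C * g + C / x) ^ 2 * (1 - η - ν) =
      ((1 + C * g + C / x) * x) ^ 2 * (1 - (η + ν)) := by rw [← hxL]; ring
  rw [e1]
  rcases le_or_gt 1 L with h1 | h1
  · rw [← hxL]
    have hx1 : 1 ≤ x := by rw [hx, Real.one_le_sqrt]; exact h1
    refine sq_mul_one_sub_ge hx1 (by linarith) (by linarith) hC₃ (by linarith)
      (by positivity) rfl ?_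
    have h2 := hη2 h1
    have h3 : 2 * ν ≤ C / x := by rwa [le_div_iff₀ hx0]
    linarith
  · have hx1 : x ≤ 1 := by rw [hx, Real.sqrt_le_one]; exact h1.le
    have h2 : C ≤ (1 + C * g + C / x) * x := by
      have : (1 + C * g + C / x) * x = x + C * g * x + C := by field_simp
      rw [this]
      have : 0 ≤ C * g * x := by positivity
      linarith
    have h3 : 2 + 4 * C₃ ≤ ((1 + C * g + C / x) * x) ^ 2 := by
      have h4 : C ^ 2 ≤ ((1 + C * g + C / x) * x) ^ 2 := by gcongr
      have h5 : (2 + 2 * C₃) ^ 2 ≤ C ^ 2 := by gcongr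
      nlinarith
    have h4 : (1 / 2 : ℝ) ≤ 1 - (η + ν) := by linarith
    have h5 : C₃ * (1 + x) ≤ 2 * C₃ := by nlinarith
    calc L + C₃ * (1 + x) ≤ (2 + 4 * C₃) * (1 / 2) := by linarith
      _ ≤ _ := by gcongr

/-- The choice of the constants. -/
lemma exists_constants {c₁ c₂ K : ℝ} (hc₁ : 0 < c₁) (hc₂ : 0 < c₂) (hK : 1 ≤ K) :
    ∃ C > 0, ∃ C₀ > 0, ∀ (L w : ℝ) (n : ℕ), 0 < L → 0 ≤ w → C₀ * (L + Real.log 4) ≤ n →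
      c₁ * max ((L / n) ^ (1 / 8 : ℝ)) ((2 : ℝ) ^ (-(c₂ * √L))) * w ≤ 1 →
      4 * √(2 * (L + Real.log 4) / n) ≤ 1 ∧
      √(L + Real.log 4) ≤ √L * (1 + C * (L / n) ^ (1 / 4 : ℝ) + C / √L) ∧
      64 * K * √(2 * (L + Real.log 4) / n) * (w * (w + 14)) ≤ 1 / 4 ∧
      ∃ (N : ℕ) (ν : ℝ), 0 < N ∧ 0 ≤ ν ∧ ν ≤ 1 / 4 ∧ 64 * (w * (w + 14)) ≤ ν * N ∧
        4 * N * Real.exp (-(L * (1 + C * (L / n) ^ (1 / 4 : ℝ) + C / √L) ^ 2 *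
          (1 - 64 * K * √(2 * (L + Real.log 4) / n) * (w * (w + 14)) - ν))) ≤ Real.exp (-L) := by
  set Γ := 1 / c₁ + 14 with hΓ
  set E := 768 * K * Γ ^ 2 * Real.exp (2 * c₂) with hE
  set C₅ := 192 * K * Γ ^ 2 with hC₅
  set C₃ := Real.log (1032 * Γ ^ 2) + 2 * c₂ + 1 with hC₃
  have hΓ1 : 14 ≤ Γ := by
    have : 0 < 1 / c₁ := by positivity
    rw [hΓ]; linarith
  have hΓ2 : 1 ≤ Γ ^ 2 := one_le_pow₀ (by linarith)
  have hlogΓ : 0 ≤ Real.log (1032 * Γ ^ 2) := Real.log_nonneg (by linarith)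
  have hC₃0 : 0 ≤ C₃ := by rw [hC₃]; positivity
  have hC₅0 : 0 < C₅ := by rw [hC₅]; positivity
  have hexp1 : 1 ≤ Real.exp (2 * c₂) := Real.one_le_exp (by positivity)
  have hKG : 1 ≤ K * Γ ^ 2 := one_le_mul_of_one_le_of_one_le hK hΓ2
  have hE1 : 1 ≤ E := by
    have : 1 ≤ K * Γ ^ 2 * Real.exp (2 * c₂) := one_le_mul_of_one_le_of_one_le hKG hexp1
    rw [hE]; linarith
  -- Here 2 covers `√(L + log 4) ≤ √L + 2`, `2 C₅` the cubic error and `2 C₃` the size of the net.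
  set C := 2 + 2 * C₅ + 2 * C₃ with hC
  have hC2 : 2 ≤ C := by rw [hC]; linarith
  refine ⟨C, by linarith, 32 * E ^ 4, by positivity, fun L w n hL hw0 hn hw => ?_⟩
  have hlog4 : 0 < Real.log 4 := Real.log_pos (by norm_num)
  have hlog4' : Real.log 4 ≤ 2 := by
    have : Real.log 4 = 2 * Real.log 2 := by
      rw [show (4 : ℝ) = 2 ^ 2 by norm_num, Real.log_pow]; norm_num
    linarith [Real.log_two_lt_d9]
  have hn0 : (0 : ℝ) < n := lt_of_lt_of_le (by positivity) hn
  have hγ0 : 0 < L / n := by positivity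
  set x := √L with hx
  have hx0 : 0 < x := Real.sqrt_pos.2 hL
  have hxL : x ^ 2 = L := Real.sq_sqrt hL.le
  have hw1 : c₁ * (L / n) ^ (1 / 8 : ℝ) * w ≤ 1 :=
    le_trans (by gcongr; exact le_max_left _ _) hw
  have hw2 : w ≤ 1 / c₁ * Real.exp (c₂ * x) :=
    le_exp_of_two_rpow_mul_le hc₁ hw0 (by positivity)
      (le_trans (by gcongr; exact le_max_right _ _) hw)
  obtain ⟨hη1, hη2⟩ := width_error_le hc₁ hc₂ hK hL hw0 hn hw1 hw2
  set η := 64 * K * √(2 * (L + Real.log 4) / n) * (w * (w + 14)) with hη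
  set g := (L / n) ^ (1 / 4 : ℝ) with hg
  have hg0 : 0 ≤ g := Real.rpow_nonneg hγ0.le _
  have hη0 : 0 ≤ η := by rw [hη]; positivity
  refine ⟨?_, ?_, hη1, ?_⟩
  · have : √(2 * (L + Real.log 4) / n) ≤ 1 / 4 := by
      rw [Real.sqrt_le_left (by norm_num), div_le_iff₀ hn0]
      have h1 : 32 * 1 * (L + Real.log 4) ≤ 32 * E ^ 4 * (L + Real.log 4) := by
        gcongr
        exact one_le_pow₀ hE1
      linarith
    linarith
  · have h1 : √(L + Real.log 4) ≤ x + 2 := by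
      rw [Real.sqrt_le_left (by linarith), add_sq, hxL]
      linarith
    have h2 : x * (1 + C * g + C / x) = x + x * (C * g) + C := by field_simp
    have h3 : 0 ≤ x * (C * g) := by positivity
    rw [h2]
    linarith
  · obtain ⟨N, hN, hNge, hNle⟩ := exists_net_size hc₁ hc₂ hL hw0 hw2
    have hs1 : 1 ≤ √(L + 1) := by rw [Real.one_le_sqrt]; linarith
    have hν1 : 1 / (4 * √(L + 1)) ≤ 1 / 4 :=
      one_div_le_one_div_of_le (by norm_num) (by linarith)
    -- The loss from discretization may be of order `1 / √L`, matching the term `C / √L`; the shift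
    -- by 1 keeps it at most `1 / 4` for small `L`.
    refine ⟨N, 1 / (4 * √(L + 1)), hN, by positivity, hν1, hNge, ?_⟩
    have hν2 : 2 * (1 / (4 * √(L + 1))) * x ≤ C := by
      have hxs : x ≤ √(L + 1) := Real.sqrt_le_sqrt (by linarith)
      rw [mul_one_div, div_mul_eq_mul_div, div_le_iff₀ (by positivity)]
      calc 2 * x ≤ 2 * (4 * √(L + 1)) := by linarith
        _ ≤ C * (4 * √(L + 1)) := by gcongr
    have hmain := exponent_ge hL hg0 hC₃0 (by rw [hC]; linarith : 2 + 2 * C₃ ≤ C) hη0 hη1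
      (fun h1 => by
        have h2 := hη2 h1
        have h3 : 2 * C₅ * g ≤ C * g := by gcongr; rw [hC]; linarith
        linarith) (by positivity) hν1 hν2
    calc 4 * N * Real.exp (-(L * (1 + C * g + C / x) ^ 2 * (1 - η - 1 / (4 * √(L + 1)))))
        ≤ Real.exp (C₃ * (1 + x)) * Real.exp (-(L + C₃ * (1 + x))) := by
          gcongr
      _ = Real.exp (-L) := by rw [← Real.exp_add]; ring_nf

end

end LocationMLE

/-! ### Assembly -/

namespace LocationMLE

noncomputable section

lemma one_le_scoreConst : 1 ≤ scoreConst := by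
  have : 1 ≤ Real.exp 39 := Real.one_le_exp (by norm_num)
  unfold scoreConst
  linarith

/-- The failure probability of the global procedure for a given accuracy `ε₀`, in terms of the
parameters of a net for the distances between `ε₀` and the length of the window. -/
lemma measureReal_globalMLE_fail_le {Ω : Type*} {mΩ : MeasurableSpace Ω} {P : Measure Ω}
    [IsProbabilityMeasure P] {f : Measure ℝ} [IsProbabilityMeasure f] {r : ℝ} {n : ℕ}
    (hr : 0 < r) (hn : 0 < n) {lam t α a b : ℝ} {X Z : Fin n → Ω → ℝ} (ht : 0 < t)
    (hw : IsShortestWindow f t α a b)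
    (hX : ∀ i, HasLaw (X i) (f.map (fun y => lam + y)) P)
    (hZ : ∀ i, HasLaw (Z i) (gaussianReal 0 (r ^ 2).toNNReal) P)
    (hind : iIndepFun (Sum.elim X Z) P) {ε₀ η ν : ℝ} {N : ℕ} (hε₀ : 0 < ε₀)
    (hDr : b - a ≤ r) (hN : 0 < N)
    (hη : 2 * scoreConst * (b - a) ≤ η * (r ^ 2 * √(fisherInfo f r)))
    (hν : 2 * (b - a) ≤ ν * (N * (r ^ 2 * (ε₀ * fisherInfo f r)))) (hην : η + ν ≤ 1) :
    P.real {ω | ¬ ((∃ θ, IsGlobalMLEOutput f r α a b (fun i => X i ω) (fun i => Z i ω) θ) ∧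
        ∀ θ, IsGlobalMLEOutput f r α a b (fun i => X i ω) (fun i => Z i ω) θ →
          |θ - lam| ≤ ε₀)} ≤
      2 * Real.exp (-2 * n * t ^ 2) +
        2 * N * Real.exp (-(n * ε₀ ^ 2 * fisherInfo f r / 2 * (1 - η - ν))) := by
  have hXind : iIndepFun X P := hind.precomp (g := Sum.inl) Sum.inl_injective
  have hmiss := measureReal_window_miss_le hn ht hw hX hXind
  set B₁ := {ω | ∃ q, IsSampleQuantile (fun i => X i ω) α q ∧ lam ∉ Set.Icc (q - b) (q - a)}
  have hlen : ∀ q : ℝ, q - a - (q - b) = b - a := fun q => by ring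
  -- If the window is shorter than `ε₀`, containing `lam` is already enough and no sign control is
  -- needed.
  rcases lt_or_ge (b - a) ε₀ with hcase | hcase
  · refine (measureReal_mono (s₂ := B₁) fun ω hω => ?_).trans
      (hmiss.trans (le_add_of_nonneg_right (by positivity)))
    by_contra hnot
    refine hω ⟨exists_isGlobalMLEOutput hr hn ht hw _ _, ?_⟩
    rintro θ ⟨q, hq, hθ⟩
    have hlam : lam ∈ Set.Icc (q - b) (q - a) := by
      by_contra h
      exact hnot ⟨q, hq, h⟩
    refine hθ.abs_sub_le hlam hε₀.le (fun ε h1 h2 => ?_) fun ε h1 h2 => ?_ <;>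
    · rw [hlen] at h2
      linarith
  · have hsign := measureReal_wrong_sign_le hr hX hZ hind hε₀ hcase hDr hN hη hν hην
    refine (measureReal_mono fun ω hω => ?_).trans
      ((measureReal_union_le B₁ _).trans (add_le_add hmiss hsign))
    by_contra hnot
    rw [Set.mem_union, not_or] at hnot
    obtain ⟨hnot₁, hnot₂⟩ := hnot
    rw [Set.mem_ofPred_eq, not_not] at hnot₂
    refine hω ⟨exists_isGlobalMLEOutput hr hn ht hw _ _, ?_⟩
    rintro θ ⟨q, hq, hθ⟩
    have hlam : lam ∈ Set.Icc (q - b) (q - a) := by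
      by_contra h
      exact hnot₁ ⟨q, hq, h⟩
    refine hθ.abs_sub_le hlam hε₀.le (fun ε h1 h2 => ?_) fun ε h1 h2 => ?_
    · exact hnot₂.1 ε h1 (by rwa [hlen] at h2)
    · exact hnot₂.2 ε h1 (by rwa [hlen] at h2)

end

end LocationMLE

open LocationMLE
theorem theorem3 (c₁ c₂ : ℝ) (hc₁ : 0 < c₁) (hc₂ : 0 < c₂) :
    ∃ C > 0, ∃ C₀ > 0,
      ∀ (f : Measure ℝ) [IsProbabilityMeasure f] (q₁ q₃ δ r : ℝ) (n : ℕ),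
        IsQuantile f (1 / 4) q₁ → IsQuantile f (3 / 4) q₃ →
        0 < δ → δ < 1 → C₀ * Real.log (4 / δ) ≤ n →
        0 < r →
        c₁ * max ((Real.log (1 / δ) / n) ^ (1 / 8 : ℝ))
            ((2 : ℝ) ^ (-(c₂ * √(Real.log (1 / δ))))) * (q₃ - q₁) ≤ r →
        (∃ α a b : ℝ, IsShortestWindow f (quantileRadius δ n) α a b) ∧
        ∀ α a b : ℝ, IsShortestWindow f (quantileRadius δ n) α a b →
        ∀ (Ω : Type*) [MeasurableSpace Ω] (P : Measure Ω) [IsProbabilityMeasure P]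
          (lam : ℝ) (X Z : Fin n → Ω → ℝ),
          (∀ i, HasLaw (X i) (f.map (fun y => lam + y)) P) →
          (∀ i, HasLaw (Z i) (gaussianReal 0 (r ^ 2).toNNReal) P) →
          iIndepFun (Sum.elim X Z) P →
          P {ω | ¬ ((∃ θ, IsGlobalMLEOutput f r α a b (fun i => X i ω) (fun i => Z i ω) θ) ∧
              ∀ θ, IsGlobalMLEOutput f r α a b (fun i => X i ω) (fun i => Z i ω) θ →
                |θ - lam| ≤
                  (1 + C * (Real.log (1 / δ) / n) ^ (1 / 4 : ℝ)
                      + C / √(Real.log (1 / δ)))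
                    * √(2 * Real.log (1 / δ) / (n * fisherInfo f r)))}
            ≤ ENNReal.ofReal δ := by
  obtain ⟨C, hC, C₀, hC₀, hconst⟩ := exists_constants hc₁ hc₂ one_le_scoreConst
  refine ⟨C, hC, C₀, hC₀, fun f _ q₁ q₃ δ r n hq₁ hq₃ hδ0 hδ1 hn hr hwidth => ?_⟩
  have hL4 : Real.log (4 / δ) = Real.log (1 / δ) + Real.log 4 := by
    rw [Real.log_div (by norm_num) hδ0.ne', Real.log_div one_ne_zero hδ0.ne', Real.log_one]
    ring
  have hexpL : Real.exp (-Real.log (1 / δ)) = δ := by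
    rw [one_div, Real.log_inv, neg_neg, Real.exp_log hδ0]
  have hL : 0 < Real.log (1 / δ) := Real.log_pos (by rw [lt_div_iff₀ hδ0]; linarith)
  have ht_eq : quantileRadius δ n = √(2 * (Real.log (1 / δ) + Real.log 4) / n) := by
    rw [quantileRadius, hL4]
  rw [hL4] at hn
  generalize Real.log (1 / δ) = L at *
  have hlog4 : 0 < Real.log 4 := Real.log_pos (by norm_num)
  have hn0 : (0 : ℝ) < n := lt_of_lt_of_le (by positivity) hn
  have hnpos : 0 < n := by exact_mod_cast hn0
  have hq := quantile_le_quantile hq₁ hq₃ (by norm_num)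
  have hmass : 1 / 2 ≤ f.real (Set.Icc q₁ q₃) :=
    le_trans (by norm_num) (sub_le_measureReal_Icc hq₁ hq₃)
  -- By scaling, only the ratio of the interquartile range to `r` enters the error terms.
  set w := (q₃ - q₁) / r with hw
  have hwr : w * r = q₃ - q₁ := by rw [hw]; field_simp
  have hw0 : 0 ≤ w := div_nonneg (sub_nonneg.2 hq) hr.le
  obtain ⟨ht4, hB, hη, N, ν, hN, hν0, hν1, hNν, hexp⟩ := hconst L w n hL hw0 hn (by
    rw [hw, ← mul_div_assoc, div_le_one hr]
    exact hwidth)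
  rw [← ht_eq] at ht4 hη hexp
  set t := quantileRadius δ n
  have ht0 : 0 < t := by rw [ht_eq]; positivity
  refine ⟨?_, fun α a b hwin Ω _ P _ lam X Z hX hZ hind => ?_⟩
  · obtain ⟨α, a, b, h, -⟩ := exists_isShortestWindow (f := f) ht0 (by linarith)
    exact ⟨α, a, b, h⟩
  have hI := one_le_sqrt_fisherInfo (f := f) hr hq hmass
  rw [← hwr] at hI
  have hlen := hwin.length_le ht0 ht4 hq hmass
  rw [← hwr] at hlen
  have hI0 : 0 < fisherInfo f r := by
    by_contra! h
    rw [Real.sqrt_eq_zero_of_nonpos h, mul_zero] at hI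
    linarith
  set I := fisherInfo f r
  set B := 1 + C * (L / n) ^ (1 / 4 : ℝ) + C / √L
  have hB0 : 0 < B := by positivity
  have hK := one_le_scoreConst
  set ε₀ := B * √(2 * L / (n * I)) with hε₀
  have hsI : √I * √I = I := Real.mul_self_sqrt hI0.le
  have hε₀sq : n * ε₀ ^ 2 * I / 2 = L * B ^ 2 := by
    rw [hε₀, mul_pow, Real.sq_sqrt (by positivity)]
    field_simp
  -- The target accuracy is at least `t / √I`, because `B √L ≥ √(L + log 4)`. Through it the net
  -- condition `hν` loses its factor `t` and becomes a condition on `w` alone.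
  have hε₀t : t * √I ≤ ε₀ * I := by
    have h1 : ε₀ * √I = √L * B * √(2 / n) := by
      have h2 : 2 * L / (n * I) * I = L * (2 / n) := by field_simp
      rw [hε₀, mul_assoc, ← Real.sqrt_mul (by positivity), h2, Real.sqrt_mul hL.le]
      ring
    have h3 : t = √(L + Real.log 4) * √(2 / n) := by
      rw [ht_eq, ← Real.sqrt_mul (by positivity)]
      congr 1
      ring
    calc t * √I ≤ (√L * B * √(2 / n)) * √I := by rw [h3]; gcongr
      _ = ε₀ * (√I * √I) := by rw [← h1]; ring
      _ = ε₀ * I := by rw [hsI]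
  have hlow : t * w ≤ 4 * (t * (w * (w + 14))) * (r * √I) := by
    calc t * w = t * w * 1 := (mul_one _).symm
      _ ≤ t * w * (4 * (w * r + 14 * r) * √I) := by gcongr
      _ = _ := by ring
  have hfail := measureReal_globalMLE_fail_le hr hnpos ht0 hwin hX hZ hind
    (ε₀ := ε₀) (η := 64 * scoreConst * t * (w * (w + 14))) (ν := ν) (N := N) (by positivity)
    (by
      have h1 : 8 * (t * w) ≤ 64 * scoreConst * t * (w * (w + 14)) := by
        have h2 : 1 * 1 ≤ scoreConst * (w + 14) :=
          mul_le_mul hK (by linarith) zero_le_one (by linarith)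
        have h3 : 0 ≤ t * w := by positivity
        calc 8 * (t * w) ≤ 64 * (t * w) * (1 * 1) := by linarith
          _ ≤ 64 * (t * w) * (scoreConst * (w + 14)) := by gcongr
          _ = _ := by ring
      calc b - a ≤ 8 * (t * w) * r := by linarith
        _ ≤ 1 * r := by gcongr; linarith
        _ = r := one_mul r) hN
    (by
      calc 2 * scoreConst * (b - a) ≤ 2 * scoreConst * (8 * t * (w * r)) := by gcongr
        _ = 16 * scoreConst * r * (t * w) := by ring
        _ ≤ 16 * scoreConst * r * (4 * (t * (w * (w + 14))) * (r * √I)) := by gcongr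
        _ = _ := by ring)
    (by
      calc 2 * (b - a) ≤ 2 * (8 * t * (w * r)) := by gcongr
        _ = 16 * r * (t * w) := by ring
        _ ≤ 16 * r * (4 * (t * (w * (w + 14))) * (r * √I)) := by gcongr
        _ = 64 * (w * (w + 14)) * (r ^ 2 * (t * √I)) := by ring
        _ ≤ ν * N * (r ^ 2 * (ε₀ * I)) := by gcongr
        _ = _ := by ring) (by linarith)
  -- The miss probability is at most `2 * (δ / 4)`; `hexp` bounds the two-sided union over the net
  -- by `δ / 2`.
  have hmiss : Real.exp (-2 * n * t ^ 2) ≤ δ / 4 := by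
    have h1 : -2 * n * t ^ 2 = -(4 * (L + Real.log 4)) := by
      rw [ht_eq, Real.sq_sqrt (by positivity)]
      field_simp
      norm_num
    calc Real.exp (-2 * n * t ^ 2) ≤ Real.exp (-L - Real.log 4) := by
          rw [h1]; exact Real.exp_le_exp.2 (by linarith)
      _ = δ / 4 := by rw [Real.exp_sub, hexpL, Real.exp_log (by norm_num)]
  rw [hε₀sq] at hfail
  rw [hexpL] at hexp
  rw [← ofReal_measureReal]
  exact ENNReal.ofReal_le_ofReal (hfail.trans (by linarith))
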